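/- **Theorem.** Let $H$ be a finite-dimensional Hopf algebra over a field $k$ with counit $\epsilon$, and fix a left integral $\Lambda$ of $H$, i.e. an element $\Lambda \neq 0$ of $H$ with $h\Lambda=\epsilon(h)\Lambda$ for all $h\in H$. Let $A$ be a left $H$-comodule algebra: an associative unital $k$-algebra with a coassociative and counital coaction $\Delta_A: A\to H\otimes A$ that is a homomorphism of $k$-algebras (all tensor products are over $k$). For an $H$-module $V$ and a left $A$-module $M$, regard $V\otimes M$ as an $A$-module via $\Delta_A$. Call a morphism of $A$-modules null-homotopic if it factors through an $A$-module of the form $H\otimes N$, with $N$ an $A$-module, and let $A_H\text{-}\underline{\mathrm{mod}}$ be the quotient of the category of left $A$-modules by the ideal of null-homotopic morphisms. Put $T(M)=(H/k\Lambda)\otimes M$. For a morphism of $A$-modules $u: X\to Y$ let $C_u$ be the pushout of $u$ along the map $x: X\to H\otimes X$, $x(m)=\Lambda\otimes m$; let $v:Y\to C_u$ be the canonical map, and let $w: C_u\to T(X)$ be the map with $wv=0$ whose composite with $H\otimes X\to C_u$ is the quotient map $H\otimes X\to (H/k\Lambda)\otimes X$. Call a triangle in $A_H\text{-}\underline{\mathrm{mod}}$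 distinguished if it is isomorphic in $A_H\text{-}\underline{\mathrm{mod}}$ to the image of $X\xrightarrow{u}Y\xrightarrow{v}C_u\xrightarrow{w}T(X)$ for some morphism $u$ of $A$-modules. Then $T$ induces an additive self-equivalence of $A_H\text{-}\underline{\mathrm{mod}}$, and $A_H\text{-}\underline{\mathrm{mod}}$, with the shift functor $T$ and these distinguished triangles, is a triangulated category (the octahedral axiom included). -/

import Mathlib

noncomputable section

namespace Hopfological

open CategoryTheory CategoryTheory.Limits CategoryTheory.Pretriangulated TensorProduct
open scoped ModuleCat

universe u v u'

/-- A left integral of a Hopf algebra `H`: a nonzero `Λ` with `h Λ = ε(h) Λ` for all `h`. -/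
structure LeftIntegral (k : Type u) (H : Type v) [Field k] [Ring H] [HopfAlgebra k H] where
  elt : H
  ne_zero : elt ≠ 0
  mul_elt : ∀ h : H, h * elt = Coalgebra.counit (R := k) h • elt

/-- The line `kΛ`, which is a left ideal of `H`. -/
def LeftIntegral.line {k : Type u} {H : Type v} [Field k] [Ring H] [HopfAlgebra k H]
    (Λ : LeftIntegral k H) : Submodule H H where
  carrier := {x | ∃ c : k, x = c • Λ.elt}
  add_mem' := by
    rintro _ _ ⟨c, rfl⟩ ⟨d, rfl⟩
    exact ⟨c + d, (add_smul c d _).symm⟩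
  zero_mem' := ⟨0, (zero_smul k _).symm⟩
  smul_mem' := by
    rintro h _ ⟨c, rfl⟩
    refine ⟨c * Coalgebra.counit (R := k) h, ?_⟩
    rw [smul_eq_mul, mul_smul_comm, Λ.mul_elt, smul_smul]

/-- A left `H`-comodule algebra structure on a `k`-algebra `A`: a counital and coassociative
coaction `A → H ⊗ A` that is a homomorphism of `k`-algebras. -/
structure LeftComoduleAlgebra (k : Type u) (H : Type v) (A : Type u') [Field k] [Ring H]
    [HopfAlgebra k H] [Ring A] [Algebra k A] where
  coact : A →ₐ[k] H ⊗[k] A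
  counit_coact : ∀ a : A,
    TensorProduct.lid k A ((Coalgebra.counit (R := k) (A := H)).rTensor A (coact a)) = a
  coassoc : ∀ a : A,
    TensorProduct.assoc k H H A ((Coalgebra.comul (R := k) (A := H)).rTensor A (coact a)) =
      coact.toLinearMap.lTensor H (coact a)

section

variable {k : Type u} {H : Type v} {A : Type u'} [Field k] [Ring H] [HopfAlgebra k H]
  [Ring A] [Algebra k A] (δ : LeftComoduleAlgebra k H A)

section tensor

variable (V W : Type v) [AddCommGroup V] [Module k V] [Module H V] [IsScalarTower k H V]
  [AddCommGroup W] [Module k W] [Module H W] [IsScalarTower k H W]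
  (M N : Type v) [AddCommGroup M] [Module k M] [Module A M] [IsScalarTower k A M]
  [AddCommGroup N] [Module k N] [Module A N] [IsScalarTower k A N]

/-- The action of `A` on `V ⊗ M`, for `V` an `H`-module and `M` an `A`-module:
`A → H ⊗ A → End V ⊗ End M → End (V ⊗ M)`. -/
def tensorAction : A →ₐ[k] Module.End k (V ⊗[k] M) :=
  (Module.endTensorEndAlgHom (R := k) (S := k) (A := k) (M := V) (N := M)).comp
    ((Algebra.TensorProduct.map (Algebra.lsmul k k V) (Algebra.lsmul k k M)).comp δ.coact)

/-- The vector space `V ⊗ M`, to be regarded as an `A`-module through the coaction (and not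
through any action of `A` on the left factor, hence the type synonym). -/
def TensorObj (_ : LeftComoduleAlgebra k H A) (V M : Type v) [AddCommGroup V] [Module k V]
    [AddCommGroup M] [Module k M] : Type v := V ⊗[k] M

instance : AddCommGroup (TensorObj δ V M) := inferInstanceAs (AddCommGroup (V ⊗[k] M))

instance : Module A (TensorObj δ V M) :=
  Module.compHom (V ⊗[k] M) (tensorAction δ V M).toRingHom

variable {V W M N}

/-- The action of `h ⊗ a ∈ H ⊗ A` on `V ⊗ M` commutes with `φ ⊗ f` for `φ` an `H`-linear map
and `f` an `A`-linear map. -/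
lemma map_tensorAction (φ : V →ₗ[H] W) (f : M →ₗ[A] N) (a : A) (x : V ⊗[k] M) :
    TensorProduct.map (φ.restrictScalars k) (f.restrictScalars k) (tensorAction δ V M a x) =
      tensorAction δ W N a
        (TensorProduct.map (φ.restrictScalars k) (f.restrictScalars k) x) := by
  simp only [tensorAction, AlgHom.comp_apply]
  induction δ.coact a using TensorProduct.induction_on with
  | zero => simp
  | add y z hy hz => simp only [map_add, LinearMap.add_apply, hy, hz]
  | tmul h b =>
    induction x using TensorProduct.induction_on with
    | zero => simp
    | add y z hy hz => simp only [map_add, hy, hz]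
    | tmul v m => simp [Module.endTensorEndAlgHom_apply]

/-- The `A`-linear map `φ ⊗ f : V ⊗ M → W ⊗ N`. -/
def tensorMap (φ : V →ₗ[H] W) (f : M →ₗ[A] N) : TensorObj δ V M →ₗ[A] TensorObj δ W N where
  toFun := TensorProduct.map (φ.restrictScalars k) (f.restrictScalars k)
  map_add' := fun x y => map_add
    (TensorProduct.map (φ.restrictScalars k) (f.restrictScalars k)) x y
  map_smul' := fun a x => map_tensorAction δ φ f a x

/-- The `A`-linear map `M → H ⊗ M`, `m ↦ Λ ⊗ m`. -/
def integralMap (Λ : LeftIntegral k H) : M →ₗ[A] TensorObj δ H M where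
  toFun := fun m => (Λ.elt ⊗ₜ[k] m : H ⊗[k] M)
  map_add' := fun m n => TensorProduct.tmul_add Λ.elt m n
  map_smul' := by
    intro a m
    change (Λ.elt ⊗ₜ[k] (a • m) : H ⊗[k] M) = tensorAction δ H M a (Λ.elt ⊗ₜ[k] m)
    have key : ∀ y : H ⊗[k] A,
        (Λ.elt ⊗ₜ[k]
          ((TensorProduct.lid k A ((Coalgebra.counit (R := k) (A := H)).rTensor A y)) • m) :
            H ⊗[k] M) =
        Module.endTensorEndAlgHom (R := k) (S := k) (A := k) (M := H) (N := M)
          (Algebra.TensorProduct.map (Algebra.lsmul k k H) (Algebra.lsmul k k M) y)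
          (Λ.elt ⊗ₜ[k] m) := by
      intro y
      induction y using TensorProduct.induction_on with
      | zero => simp
      | add y z hy hz =>
        simp only [map_add, LinearMap.add_apply, ← hy, ← hz, add_smul, TensorProduct.tmul_add]
      | tmul h b => simp [Module.endTensorEndAlgHom_apply, Λ.mul_elt, TensorProduct.smul_tmul']
    have := key (δ.coact a)
    rwa [δ.counit_coact] at this

end tensor

/-- The functor `V ⊗ - : A-mod ⥤ A-mod`, for an `H`-module `V`. -/
def tensorFunctor (V : Type v) [AddCommGroup V] [Module k V] [Module H V]
    [IsScalarTower k H V] : ModuleCat.{v} A ⥤ ModuleCat.{v} A where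
  obj M := ModuleCat.of A (TensorObj δ V M)
  map f := ModuleCat.ofHom (tensorMap δ (LinearMap.id : V →ₗ[H] V) f.hom)
  map_id M := by
    ext x
    exact LinearMap.congr_fun (TensorProduct.map_id (R := k) (M := V) (N := M)) x
  map_comp {M N P} f g := by
    ext x
    exact LinearMap.congr_fun (TensorProduct.map_comp
      (LinearMap.id : V →ₗ[k] V) (g.hom.restrictScalars k)
      (LinearMap.id : V →ₗ[k] V) (f.hom.restrictScalars k)) x

instance (V : Type v) [AddCommGroup V] [Module k V] [Module H V] [IsScalarTower k H V] :
    (tensorFunctor δ V).Additive where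
  map_add {M N} f g := by
    ext x
    exact LinearMap.congr_fun (TensorProduct.map_add_right
      (LinearMap.id : V →ₗ[k] V) (f.hom.restrictScalars k) (g.hom.restrictScalars k)) x

/-- A morphism of `A`-modules is null-homotopic if it factors through some `H ⊗ N`. -/
def NullHomotopic {M₁ M₂ : ModuleCat.{v} A} (f : M₁ ⟶ M₂) : Prop :=
  ∃ (N : ModuleCat.{v} A) (g₁ : M₁ ⟶ (tensorFunctor δ H).obj N)
    (g₂ : (tensorFunctor δ H).obj N ⟶ M₂), g₁ ≫ g₂ = f

namespace NullHomotopic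

variable {δ} {M₁ M₂ M₃ : ModuleCat.{v} A}

lemma zero : NullHomotopic δ (0 : M₁ ⟶ M₂) := ⟨M₁, 0, 0, by simp⟩

lemma neg {f : M₁ ⟶ M₂} (hf : NullHomotopic δ f) : NullHomotopic δ (-f) := by
  obtain ⟨N, g₁, g₂, rfl⟩ := hf
  exact ⟨N, g₁, -g₂, by simp⟩

lemma add {f f' : M₁ ⟶ M₂} (hf : NullHomotopic δ f) (hf' : NullHomotopic δ f') :
    NullHomotopic δ (f + f') := by
  obtain ⟨N, g₁, g₂, rfl⟩ := hf
  obtain ⟨N', g₁', g₂', rfl⟩ := hf'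
  refine ⟨N ⊞ N', g₁ ≫ (tensorFunctor δ H).map biprod.inl +
      g₁' ≫ (tensorFunctor δ H).map biprod.inr,
    (tensorFunctor δ H).map biprod.fst ≫ g₂ + (tensorFunctor δ H).map biprod.snd ≫ g₂', ?_⟩
  simp [← Functor.map_comp_assoc]

lemma comp_left (f : M₁ ⟶ M₂) {g : M₂ ⟶ M₃} (hg : NullHomotopic δ g) :
    NullHomotopic δ (f ≫ g) := by
  obtain ⟨N, g₁, g₂, rfl⟩ := hg
  exact ⟨N, f ≫ g₁, g₂, by simp⟩

lemma comp_right {f : M₁ ⟶ M₂} (hf : NullHomotopic δ f) (g : M₂ ⟶ M₃) :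
    NullHomotopic δ (f ≫ g) := by
  obtain ⟨N, g₁, g₂, rfl⟩ := hf
  exact ⟨N, g₁, g₂ ≫ g, by simp⟩

end NullHomotopic

/-- Two morphisms of `A`-modules are homotopic if their difference is null-homotopic. -/
def homotopyRel : HomRel (ModuleCat.{v} A) := fun _ _ f g => NullHomotopic δ (f - g)

instance : Congruence (homotopyRel δ) where
  equivalence :=
    { refl := fun f => by
        simpa only [homotopyRel, sub_self] using NullHomotopic.zero
      symm := fun {f g} h => by
        simpa only [homotopyRel, neg_sub] using NullHomotopic.neg h
      trans := fun {f g l} h h' => by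
        simpa only [homotopyRel, sub_add_sub_cancel] using NullHomotopic.add h h' }
  comp_left f _ _ h := by
    simpa only [homotopyRel, Preadditive.comp_sub] using NullHomotopic.comp_left f h
  comp_right g h := by
    simpa only [homotopyRel, Preadditive.sub_comp] using NullHomotopic.comp_right h g

lemma homotopyRel_add ⦃X Y : ModuleCat.{v} A⦄ (f₁ f₂ g₁ g₂ : X ⟶ Y)
    (hf : homotopyRel δ f₁ f₂) (hg : homotopyRel δ g₁ g₂) :
    homotopyRel δ (f₁ + g₁) (f₂ + g₂) := by
  simpa only [homotopyRel, add_sub_add_comm] using NullHomotopic.add hf hg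

/-- The quotient of `A-mod` by the ideal of null-homotopic morphisms. -/
def StableCat : Type _ := CategoryTheory.Quotient (homotopyRel δ)

instance : Category (StableCat δ) :=
  inferInstanceAs (Category (CategoryTheory.Quotient (homotopyRel δ)))

instance : Preadditive (StableCat δ) :=
  CategoryTheory.Quotient.preadditive (homotopyRel δ) (homotopyRel_add δ)

/-- The quotient functor from `A-mod` to its stable category. -/
def toStable : ModuleCat.{v} A ⥤ StableCat δ :=
  CategoryTheory.Quotient.functor (homotopyRel δ)

instance : (toStable δ).Additive :=
  CategoryTheory.Quotient.functor_additive (homotopyRel δ) (homotopyRel_add δ)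

instance : HasZeroObject (StableCat δ) :=
  ⟨(toStable δ).obj (ModuleCat.of A PUnit),
    (toStable δ).map_isZero (ModuleCat.isZero_of_subsingleton _)⟩

variable (Λ : LeftIntegral k H)

/-- The functor `T M = (H / kΛ) ⊗ M` on `A`-modules. -/
def shiftT : ModuleCat.{v} A ⥤ ModuleCat.{v} A := tensorFunctor δ (H ⧸ Λ.line)

variable {δ} in
/-- The inclusion `x = Λ ⊗ Id : X → H ⊗ X`. -/
def unitMap (X : ModuleCat.{v} A) : X ⟶ (tensorFunctor δ H).obj X :=
  ModuleCat.ofHom (integralMap δ Λ)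

variable {δ} in
/-- The quotient map `H ⊗ X → T X = (H / kΛ) ⊗ X`. -/
def quotMap (X : ModuleCat.{v} A) : (tensorFunctor δ H).obj X ⟶ (shiftT δ Λ).obj X :=
  ModuleCat.ofHom (tensorMap δ Λ.line.mkQ LinearMap.id)

lemma unitMap_quotMap (X : ModuleCat.{v} A) :
    unitMap (δ := δ) Λ X ≫ quotMap Λ X = 0 := by
  ext x
  change ((Λ.line.mkQ Λ.elt) ⊗ₜ[k] x : (H ⧸ Λ.line) ⊗[k] X) = 0
  have : Λ.line.mkQ Λ.elt = 0 := by
    rw [Submodule.mkQ_apply, Submodule.Quotient.mk_eq_zero]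
    exact ⟨1, (one_smul k _).symm⟩
  rw [this, TensorProduct.zero_tmul]

variable {X Y : ModuleCat.{v} A} (u : X ⟶ Y)

/-- The cone `C_u` of `u : X ⟶ Y`: the pushout of `u` along `X → H ⊗ X`. -/
def cone : ModuleCat.{v} A := pushout u (unitMap (δ := δ) Λ X)

/-- The morphism `v : Y ⟶ C_u` of the pushout square. -/
def coneIn : Y ⟶ cone δ Λ u := pushout.inl u (unitMap (δ := δ) Λ X)

/-- The morphism `w : C_u ⟶ T X` which vanishes on `Y` and is the quotient map on `H ⊗ X`. -/
def coneOut : cone δ Λ u ⟶ (shiftT δ Λ).obj X :=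
  pushout.desc 0 (quotMap Λ X) (by rw [comp_zero, unitMap_quotMap])

variable [HasShift (StableCat δ) ℤ]

/-- The standard triangle `X ⟶ Y ⟶ C_u ⟶ T X` in the stable category. Here `e` identifies the
shift functor `⟦1⟧` of the stable category with the functor that `T` induces on it. -/
def standardTriangle
    (e : toStable δ ⋙ shiftFunctor (StableCat δ) (1 : ℤ) ≅ shiftT δ Λ ⋙ toStable δ) :
    Triangle (StableCat δ) :=
  Triangle.mk ((toStable δ).map u) ((toStable δ).map (coneIn δ Λ u))
    ((toStable δ).map (coneOut δ Λ u) ≫ e.inv.app X)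

end

end Hopfological

end

/-! The stable category arises from a relative Frobenius structure, and the argument is Happel's.
Put `I = H ⊗ -`. Every module embeds in `I X` by `Λ ⊗ -` with cokernel `T X`, and is a quotient of
`I X` by the counit. These maps split on objects `I N`, and split after applying `I`. Hence maps
into `I N` extend along `X ⟶ I X`, maps from `I N` lift along `I Y ⟶ T Y`, and null maps are those
extending to `I X`. Comparing `X ⟶ I X ⟶ T X` with the kernel sequence of `I W ⟶ W` makes `T` an
equivalence modulo null maps.

The triangle axioms then reduce to `dist_of_exact`: if `ι X` extends along `i : X ⟶ Y`, the cokernel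
of `i` is stably its cone. Adding a summand `I X` to the target, which is stably zero, brings any
map into this form, and the octahedron becomes the sequence of cokernels of `i`, `i ≫ j`, `j`.

The splittings come from Hopf algebra. The counit is split by the comultiplication. The embeddings
are split by `a ⊗ b ↦ φ(S(a₂) b) a₁`, which is `H`-linear for the diagonal action by the Galois
isomorphism `H ⊗ H ≅ H ⊗ H`. One splitting needs `φ(Λ) = 1`, the other `Λ₁ φ(S(Λ₂)) = 1`; the latter
is solvable because `μ ↦ μ(Λ₁) Λ₂` and the antipode are bijective.

A coherent action of `ℤ` is obtained by replacing objects with spectra, on which shifting is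
reindexing. -/

namespace CategoryTheory

/-! ### Spectra and the integer shift attached to a self-equivalence -/

open Category Limits

universe w₁ w₂

variable {C : Type w₁} [Category.{w₂} C]

/-- A spectrum for an endofunctor `T`: a family of objects `Xₙ` indexed by `ℤ`, with
isomorphisms `T Xₙ ≅ Xₙ₊₁`. -/
structure Spectrum (T : C ⥤ C) where
  X : ℤ → C
  iso : ∀ i j : ℤ, i + 1 = j → (T.obj (X i) ≅ X j)

namespace Spectrum

variable {T : C ⥤ C}

/-- A morphism of spectra is a family of morphisms compatible with the structure isomorphisms. -/
@[ext]
structure Hom (X Y : Spectrum T) where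
  f : ∀ i, X.X i ⟶ Y.X i
  comm : ∀ i j h, (X.iso i j h).hom ≫ f j = T.map (f i) ≫ (Y.iso i j h).hom

lemma Hom.comm_assoc {X Y : Spectrum T} (φ : Hom X Y) (i j : ℤ) (h : i + 1 = j) {Z : C}
    (g : Y.X j ⟶ Z) :
    (X.iso i j h).hom ≫ φ.f j ≫ g = T.map (φ.f i) ≫ (Y.iso i j h).hom ≫ g := by
  rw [← assoc, φ.comm, assoc]

instance : Category (Spectrum T) where
  Hom := Hom
  id X := { f := fun i => 𝟙 _, comm := by simp }
  comp φ ψ := { f := fun i => φ.f i ≫ ψ.f i, comm := by simp [Hom.comm_assoc, Hom.comm] }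
  id_comp f := by apply Hom.ext; simp
  comp_id f := by apply Hom.ext; simp
  assoc f g h := by apply Hom.ext; simp

@[ext]
lemma hom_ext {X Y : Spectrum T} {f g : X ⟶ Y} (h : ∀ i, f.f i = g.f i) : f = g :=
  Hom.ext (funext h)

@[simp] lemma id_f (X : Spectrum T) (i : ℤ) : Hom.f (𝟙 X) i = 𝟙 _ := rfl

@[simp] lemma comp_f {X Y Z : Spectrum T} (f : X ⟶ Y) (g : Y ⟶ Z) (i : ℤ) :
    (f ≫ g).f i = f.f i ≫ g.f i := rfl

/-- The evaluation of spectra in degree `i`. -/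
@[simps]
def eval (T : C ⥤ C) (i : ℤ) : Spectrum T ⥤ C where
  obj X := X.X i
  map f := f.f i

/-- Evaluations in consecutive degrees differ by `T`. -/
def evalCompIso (T : C ⥤ C) (i j : ℤ) (h : i + 1 = j) : eval T i ⋙ T ≅ eval T j :=
  NatIso.ofComponents (fun X => X.iso i j h) (fun f => (f.comm i j h).symm)

/-- The isomorphism `Xᵢ ≅ Xⱼ` for `i = j`. -/
def XIsoOfEq (X : Spectrum T) {i j : ℤ} (h : i = j) : X.X i ≅ X.X j := eqToIso (by rw [h])

@[simp] lemma XIsoOfEq_rfl (X : Spectrum T) (i : ℤ) : X.XIsoOfEq (rfl : i = i) = Iso.refl _ := rfl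

lemma XIsoOfEq_iso (X : Spectrum T) {i i' j j' : ℤ} (hi : i = i') (hj : j = j') (h : i + 1 = j)
    (h' : i' + 1 = j') : (X.iso i j h).hom ≫ (X.XIsoOfEq hj).hom =
      T.map (X.XIsoOfEq hi).hom ≫ (X.iso i' j' h').hom := by
  subst hi hj; simp

lemma XIsoOfEq_naturality {X Y : Spectrum T} (f : X ⟶ Y) {i j : ℤ} (h : i = j) :
    f.f i ≫ (Y.XIsoOfEq h).hom = (X.XIsoOfEq h).hom ≫ f.f j := by
  subst h; simp

/-- An isomorphism of spectra from its components. -/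
def isoMk {X Y : Spectrum T} (e : ∀ i, X.X i ≅ Y.X i)
    (h : ∀ i j h, (X.iso i j h).hom ≫ (e j).hom = T.map (e i).hom ≫ (Y.iso i j h).hom) :
    X ≅ Y where
  hom := { f := fun i => (e i).hom, comm := h }
  inv :=
    { f := fun i => (e i).inv
      comm := fun i j hij => by
        rw [← cancel_mono (e j).hom, assoc, assoc, Iso.inv_hom_id, comp_id, h i j hij,
          ← Functor.map_comp_assoc, Iso.inv_hom_id, Functor.map_id, id_comp] }

/-- The reindexing functors on spectra. -/
@[simps]
def shift (T : C ⥤ C) (a : ℤ) : Spectrum T ⥤ Spectrum T where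
  obj X :=
    { X := fun i => X.X (i + a)
      iso := fun i j h => X.iso (i + a) (j + a) (by lia) }
  map f := { f := fun i => f.f (i + a), comm := fun _ _ _ => f.comm _ _ _ }

lemma eqToHom_f {X Y : Spectrum T} (h : X = Y) (i : ℤ) :
    Hom.f (eqToHom h) i = eqToHom (by rw [h]) := by
  subst h; rfl

instance : HasShift (Spectrum T) ℤ :=
  hasShiftMk _ _
    { F := shift T
      zero := NatIso.ofComponents (fun X => isoMk (fun i => X.XIsoOfEq (by simp))
        (fun i j h => X.XIsoOfEq_iso _ _ _ _)) (fun f => by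
          ext i
          exact XIsoOfEq_naturality f (add_zero i))
      add := fun a b => NatIso.ofComponents (fun X => isoMk (fun i => X.XIsoOfEq (by lia))
        (fun i j h => X.XIsoOfEq_iso _ _ _ _)) (fun f => by
          ext i
          exact XIsoOfEq_naturality f (show i + (a + b) = i + b + a by lia))
      -- In each degree all structure maps are transports along equalities of indices, so coherence
      -- only compares composites of `eqToHom`.
      assoc_hom_app := fun a b c X => by
        ext i
        simp only [comp_f, eqToHom_f]
        change eqToHom (congrArg X.X (show i + (a + b + c) = i + c + (a + b) by lia)) ≫
          eqToHom (congrArg X.X (show i + c + (a + b) = i + c + b + a by lia)) =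
          eqToHom (congrArg X.X (show i + (a + b + c) = i + (a + (b + c)) by lia)) ≫
          eqToHom (congrArg X.X (show i + (a + (b + c)) = i + (b + c) + a by lia)) ≫
          eqToHom (congrArg X.X (show i + (b + c) + a = i + c + b + a by lia))
        simp
      zero_add_hom_app := fun a X => by
        ext i
        simp only [comp_f, eqToHom_f]
        change eqToHom (congrArg X.X (show i + (0 + a) = i + a + 0 by lia)) =
          eqToHom (congrArg X.X (show i + (0 + a) = i + a by lia)) ≫
          eqToHom (congrArg X.X (show i + a = i + a + 0 by lia))
        simp
      add_zero_hom_app := fun a X => by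
        ext i
        simp only [comp_f, eqToHom_f]
        change eqToHom (congrArg X.X (show i + (a + 0) = i + 0 + a by lia)) =
          eqToHom (congrArg X.X (show i + (a + 0) = i + a by lia)) ≫
          eqToHom (congrArg X.X (show i + a = i + 0 + a by lia))
        simp }

instance [T.Faithful] : (eval T 0).Faithful where
  map_injective {X Y f g} h := by
    -- Upward, the structure isomorphisms determine the next component; downward, faithfulness of
    -- `T` is needed.
    ext i
    induction i using Int.induction_on with
    | zero => exact h
    | succ i hi =>
      rw [← cancel_epi (X.iso i (i + 1) rfl).hom, f.comm, g.comm, hi]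
    | pred i hi =>
      apply T.map_injective
      rw [← cancel_mono (Y.iso (-i - 1) (-i) (by lia)).hom, ← f.comm, ← g.comm, hi]

section

variable [T.Full] {X Y : Spectrum T} (f : X.X 0 ⟶ Y.X 0)

/-- The extension to nonnegative degrees of a morphism in degree zero. -/
def extendNat : ∀ n : ℕ, X.X (Int.ofNat n) ⟶ Y.X (Int.ofNat n)
  | 0 => f
  | n + 1 => (X.iso (Int.ofNat n) (Int.ofNat (n + 1)) (by simp)).inv ≫ T.map (extendNat n) ≫
      (Y.iso (Int.ofNat n) (Int.ofNat (n + 1)) (by simp)).hom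

/-- The extension to negative degrees of a morphism in degree zero. -/
noncomputable def extendNegSucc : ∀ n : ℕ, X.X (Int.negSucc n) ⟶ Y.X (Int.negSucc n)
  | 0 => T.preimage ((X.iso (Int.negSucc 0) 0 (by simp)).hom ≫ f ≫
      (Y.iso (Int.negSucc 0) 0 (by simp)).inv)
  | n + 1 => T.preimage ((X.iso (Int.negSucc (n + 1)) (Int.negSucc n) (by lia)).hom ≫
      extendNegSucc n ≫ (Y.iso (Int.negSucc (n + 1)) (Int.negSucc n) (by lia)).inv)

/-- The extension to all degrees of a morphism in degree zero. -/
noncomputable def extend : X ⟶ Y where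
  f
    | Int.ofNat n => extendNat f n
    | Int.negSucc n => extendNegSucc f n
  comm i j h := by
    subst h
    match i with
    | Int.ofNat n =>
      change _ ≫ extendNat f (n + 1) = _
      simp [extendNat]
    | Int.negSucc 0 =>
      change _ ≫ f = T.map (extendNegSucc f 0) ≫ _
      simp [extendNegSucc]
    | Int.negSucc (n + 1) =>
      change (X.iso (Int.negSucc (n + 1)) (Int.negSucc n) _).hom ≫ extendNegSucc f n =
        T.map (extendNegSucc f (n + 1)) ≫ (Y.iso (Int.negSucc (n + 1)) (Int.negSucc n) _).hom
      simp [extendNegSucc]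

instance : (eval T 0).Full where
  map_surjective f := ⟨extend f, rfl⟩

end

section

variable [T.EssSurj] (X : C)

/-- The iterates of `T` on an object. -/
def iterObj (T : C ⥤ C) (X : C) : ℕ → C
  | 0 => X
  | n + 1 => T.obj (iterObj T X n)

/-- The iterated preimages under `T` of an object. -/
noncomputable def iterPreimage (T : C ⥤ C) [T.EssSurj] (X : C) : ℕ → C
  | 0 => T.objPreimage X
  | n + 1 => T.objPreimage (iterPreimage T X n)

/-- A spectrum with a given object in degree zero. -/
noncomputable def ofObj (T : C ⥤ C) [T.EssSurj] (X : C) : Spectrum T where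
  X
    | Int.ofNat n => iterObj T X n
    | Int.negSucc n => iterPreimage T X n
  iso i j h := match i, j, h with
    | Int.ofNat n, _, rfl => Iso.refl (T.obj (iterObj T X n))
    | Int.negSucc 0, _, rfl => T.objObjPreimageIso X
    | Int.negSucc (n + 1), _, rfl => T.objObjPreimageIso (iterPreimage T X n)

instance : (eval T 0).EssSurj where
  mem_essImage X := ⟨ofObj T X, ⟨Iso.refl _⟩⟩

end

instance [T.IsEquivalence] : (eval T 0).IsEquivalence where

end Spectrum

section

variable (T : C ⥤ C) [T.IsEquivalence]

/-- The shift functors associated with a self-equivalence. -/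
noncomputable def Functor.shiftPow (n : ℤ) : C ⥤ C :=
  (Spectrum.eval T 0).inv ⋙ shiftFunctor (Spectrum T) n ⋙ Spectrum.eval T 0

/-- A self-equivalence of a category defines a shift by `ℤ`. -/
@[reducible]
noncomputable def Functor.hasShiftOfIsEquivalence : HasShift C ℤ :=
  -- The shift of spectra is pulled back along the fully faithful quasi-inverse of evaluation in
  -- degree zero.
  (Functor.FullyFaithful.ofFullyFaithful (Spectrum.eval T 0).inv).hasShift T.shiftPow
    (fun n => Functor.isoWhiskerLeft ((Spectrum.eval T 0).inv ⋙ shiftFunctor (Spectrum T) n)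
      (Spectrum.eval T 0).asEquivalence.unitIso.symm)

/-- The shift by `1` attached to a self-equivalence `T` is isomorphic to `T`. -/
noncomputable def Functor.shiftPowOneIso :
    letI := T.hasShiftOfIsEquivalence
    shiftFunctor C (1 : ℤ) ≅ T :=
  Functor.isoWhiskerLeft (Spectrum.eval T 0).inv (Spectrum.evalCompIso T 0 1 rfl).symm ≪≫
    Functor.isoWhiskerRight (Spectrum.eval T 0).asEquivalence.counitIso T ≪≫ T.leftUnitor

end

/-- A quasi-inverse of an additive equivalence is additive, and every shift is an iterate of `⟦1⟧`
or `⟦-1⟧`. -/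
lemma shiftFunctor_additive_of_one [Preadditive C] [HasShift C ℤ]
    (h : (shiftFunctor C (1 : ℤ)).Additive) (n : ℤ) : (shiftFunctor C n).Additive := by
  have : (shiftEquiv C (1 : ℤ)).functor.Additive := h
  have hneg : (shiftFunctor C (-1 : ℤ)).Additive :=
    Equivalence.inverse_additive (shiftEquiv C (1 : ℤ))
  induction n using Int.induction_on with
  | zero => exact Functor.additive_of_iso (shiftFunctorZero C ℤ).symm
  | succ i hi => exact Functor.additive_of_iso (shiftFunctorAdd C (i : ℤ) 1).symm
  | pred i hi => exact Functor.additive_of_iso (shiftFunctorAdd C (-i : ℤ) (-1)).symm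

end CategoryTheory

/-! ### Relative Frobenius structures and invertibility of the shift -/

namespace CategoryTheory

open Category Limits Pretriangulated Preadditive

universe v₁ v₂ u₁ u₂

/-- An exact endofunctor `I` of an abelian category, with natural monomorphisms `X ⟶ I X` whose
cokernel is `T X` and natural epimorphisms `I X ⟶ X`, which become split after application of `I`
and are split on the objects `I X`. With respect to the short exact sequences that are split
by `I`, this is a Frobenius category in which the objects `I X` are projective and injective. -/
structure RelativeFrobenius (C : Type u₁) [Category.{v₁} C] [Abelian C] where
  I : C ⥤ C
  T : C ⥤ C
  additive : I.Additive
  shortExact_map : ∀ S : ShortComplex C, S.ShortExact → (S.map I).ShortExact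
  ι : ∀ X, X ⟶ I.obj X
  q : ∀ X, I.obj X ⟶ T.obj X
  ε : ∀ X, I.obj X ⟶ X
  ι_naturality : ∀ {X Y : C} (f : X ⟶ Y), f ≫ ι Y = ι X ≫ I.map f
  q_naturality : ∀ {X Y : C} (f : X ⟶ Y), I.map f ≫ q Y = q X ≫ T.map f
  ε_naturality : ∀ {X Y : C} (f : X ⟶ Y), I.map f ≫ ε Y = ε X ≫ f
  ι_q : ∀ X, ι X ≫ q X = 0
  shortExact : ∀ X, (ShortComplex.mk (ι X) (q X) (ι_q X)).ShortExact
  epi_ε : ∀ X, Epi (ε X)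
  ι_retraction : ∀ X, ∃ r, ι (I.obj X) ≫ r = 𝟙 (I.obj X)
  map_ι_retraction : ∀ X, ∃ r, I.map (ι X) ≫ r = 𝟙 (I.obj X)
  ε_section : ∀ X, ∃ s, s ≫ ε (I.obj X) = 𝟙 (I.obj X)
  map_ε_section : ∀ X, ∃ s, s ≫ I.map (ε X) = 𝟙 (I.obj X)

namespace RelativeFrobenius

attribute [instance] additive epi_ε

variable {C : Type u₁} [Category.{v₁} C] [Abelian C] (F : RelativeFrobenius C)

instance (X : C) : Mono (F.ι X) := (F.shortExact X).mono_f

instance (X : C) : Epi (F.q X) := (F.shortExact X).epi_g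

attribute [simp] ι_q

lemma ι_naturality_assoc {X Y Z : C} (f : X ⟶ Y) (g : F.I.obj Y ⟶ Z) :
    f ≫ F.ι Y ≫ g = F.ι X ≫ F.I.map f ≫ g := by
  rw [← assoc, F.ι_naturality, assoc]

@[simp]
lemma ι_q_assoc {X Z : C} (g : F.T.obj X ⟶ Z) : F.ι X ≫ F.q X ≫ g = 0 := by
  rw [← assoc, F.ι_q, zero_comp]

lemma exists_desc_q {X Y : C} (f : F.I.obj X ⟶ Y) (hf : F.ι X ≫ f = 0) :
    ∃ g, F.q X ≫ g = f :=
  ⟨(F.shortExact X).exact.desc f hf, (F.shortExact X).exact.g_desc f hf⟩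

lemma exists_lift_ι {X Y : C} (f : Y ⟶ F.I.obj X) (hf : f ≫ F.q X = 0) :
    ∃ g, g ≫ F.ι X = f :=
  ⟨(F.shortExact X).exact.lift f hf, (F.shortExact X).exact.lift_f f hf⟩

instance : F.T.Additive where
  map_add {X Y f g} := by
    rw [← cancel_epi (F.q X), comp_add, ← F.q_naturality, ← F.q_naturality, ← F.q_naturality,
      F.I.map_add, add_comp]

/-- A morphism is null if it factors through some object `I N`. -/
def Null {X Y : C} (f : X ⟶ Y) : Prop :=
  ∃ (N : C) (a : X ⟶ F.I.obj N) (b : F.I.obj N ⟶ Y), a ≫ b = f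

/-- Morphisms to `I N` extend along `X ⟶ I X`. -/
lemma exists_extension {X N : C} (f : X ⟶ F.I.obj N) : ∃ g, F.ι X ≫ g = f := by
  obtain ⟨r, hr⟩ := F.ι_retraction N
  exact ⟨F.I.map f ≫ r, by rw [← F.ι_naturality_assoc, hr, comp_id]⟩

/-- The factorization of a null map can always be taken through the canonical embedding of its
source; this is how null-homotopies are used below. -/
lemma Null.exists_factor {F : RelativeFrobenius C} {X Y : C} {f : X ⟶ Y} (hf : F.Null f) :
    ∃ g, F.ι X ≫ g = f := by
  obtain ⟨N, a, b, rfl⟩ := hf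
  obtain ⟨g, rfl⟩ := F.exists_extension a
  exact ⟨g ≫ b, by simp⟩

/-- A retraction of `I ι` splits the exact sequence obtained by applying `I` to `Y ⟶ I Y ⟶ T Y`. -/
lemma exists_section_map_q (Y : C) : ∃ s, s ≫ F.I.map (F.q Y) = 𝟙 (F.I.obj (F.T.obj Y)) := by
  obtain ⟨r, hr⟩ := F.map_ι_retraction Y
  have h := F.shortExact_map _ (F.shortExact Y)
  have := h.epi_g
  let σ := ShortComplex.Splitting.ofExactOfRetraction _ h.exact r hr h.epi_g
  exact ⟨σ.s, σ.s_g⟩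

/-- Morphisms from `I X` lift along `I Y ⟶ T Y`. -/
lemma exists_lift_q {X Y : C} (f : F.I.obj X ⟶ F.T.obj Y) : ∃ g, g ≫ F.q Y = f := by
  obtain ⟨s, hs⟩ := F.exists_section_map_q Y
  obtain ⟨t, ht⟩ := F.ε_section X
  -- The lift runs through `I X ⟶ I I X ⟶ I T Y ⟶ I I Y ⟶ I Y`; naturality of `ε` turns the section
  -- `s` of `I q` into a lift along `q`.
  refine ⟨t ≫ F.I.map f ≫ s ≫ F.ε _, ?_⟩
  simp only [assoc]
  rw [← F.ε_naturality, reassoc_of% hs, F.ε_naturality, reassoc_of% ht]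

lemma Null.exists_lift_q {F : RelativeFrobenius C} {X Y : C} {f : X ⟶ F.T.obj Y}
    (hf : F.Null f) : ∃ g, g ≫ F.q Y = f := by
  obtain ⟨N, a, b, rfl⟩ := hf
  obtain ⟨g, rfl⟩ := F.exists_lift_q b
  exact ⟨a ≫ g, by simp⟩

/-- The natural monomorphism of the kernel of `I W ⟶ W` extends to `I W`. -/
lemma exists_extension_kernel (W : C) :
    ∃ g, kernel.ι (F.ε W) ≫ g = F.ι (kernel (F.ε W)) := by
  obtain ⟨s, hs⟩ := F.map_ε_section W
  have h := F.shortExact_map (ShortComplex.mk (kernel.ι (F.ε W)) (F.ε W) (kernel.condition _))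
    { exact := ShortComplex.exact_kernel (F.ε W) }
  let σ := ShortComplex.Splitting.ofExactOfSection _ h.exact s hs h.mono_f
  obtain ⟨r, hr⟩ : ∃ r, F.I.map (kernel.ι (F.ε W)) ≫ r = 𝟙 _ := ⟨σ.r, σ.f_r⟩
  exact ⟨F.ι _ ≫ r, by rw [F.ι_naturality_assoc, hr, comp_id]⟩

section Quotient

variable {Q : Type u₂} [Category.{v₂} Q] [Preadditive Q]

/-- A functor to a preadditive category which identifies it with the quotient by the ideal of
null morphisms. -/
structure IsStableQuotient (π : C ⥤ Q) : Prop where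
  additive : π.Additive
  full : π.Full
  essSurj : π.EssSurj
  map_eq_zero_iff : ∀ {X Y : C} (f : X ⟶ Y), π.map f = 0 ↔ F.Null f

variable {F} {π : C ⥤ Q}

namespace IsStableQuotient

variable (hπ : F.IsStableQuotient π)

include hπ

lemma map_eq_map {X Y : C} {f g : X ⟶ Y} (h : F.Null (f - g)) : π.map f = π.map g := by
  have := hπ.additive
  rw [← sub_eq_zero, ← π.map_sub]
  exact (hπ.map_eq_zero_iff _).2 h

lemma null_sub {X Y : C} {f g : X ⟶ Y} (h : π.map f = π.map g) : F.Null (f - g) := by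
  have := hπ.additive
  rw [← hπ.map_eq_zero_iff, π.map_sub, h, sub_self]

lemma isZero_obj_I (X : C) : IsZero (π.obj (F.I.obj X)) := by
  rw [IsZero.iff_id_eq_zero, ← π.map_id, hπ.map_eq_zero_iff]
  exact ⟨X, 𝟙 _, 𝟙 _, by simp⟩

/-- If `f` extends to `c` on `I X`, then `I f - c ≫ ι` kills `X`, and the map it induces on `T X`
lifts `T f` along `q Y`. -/
lemma map_T_eq_zero {X Y : C} {f : X ⟶ Y} (hf : F.Null f) : π.map (F.T.map f) = 0 := by
  obtain ⟨c, hc⟩ := hf.exists_factor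
  obtain ⟨d, hd⟩ := F.exists_desc_q (F.I.map f - c ≫ F.ι Y) (by
    rw [comp_sub, reassoc_of% hc, F.ι_naturality, sub_self])
  refine (hπ.map_eq_zero_iff _).2 ⟨Y, d, F.q Y, ?_⟩
  rw [← cancel_epi (F.q X), reassoc_of% hd, sub_comp, assoc, F.ι_q, comp_zero, sub_zero,
    F.q_naturality]

/-- Lift `q ≫ f` to `g : I X ⟶ I Y` and restrict `g` to `a : X ⟶ Y`. Both `I a` and `g` extend `a ≫
ι`, so their difference descends to `T X` and exhibits `T a - f` as null. -/
lemma map_T_full {X Y : C} (f : F.T.obj X ⟶ F.T.obj Y) :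
    ∃ a : X ⟶ Y, π.map (F.T.map a) = π.map f := by
  obtain ⟨g, hg⟩ := F.exists_lift_q (F.q X ≫ f)
  obtain ⟨a, ha⟩ := F.exists_lift_ι (F.ι X ≫ g) (by rw [assoc, hg, F.ι_q_assoc])
  obtain ⟨d, hd⟩ := F.exists_desc_q (F.I.map a - g) (by
    rw [comp_sub, ← F.ι_naturality, ha, sub_self])
  refine ⟨a, hπ.map_eq_map ⟨Y, d, F.q Y, ?_⟩⟩
  rw [← cancel_epi (F.q X), reassoc_of% hd, sub_comp, hg, F.q_naturality, comp_sub]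

/-- Dual to the vanishing of `T` on null maps: a lift `d` of `T f` to `I Y` corrects `I f` to a map
landing in `Y`, which extends `f` to `I X`. -/
lemma map_T_faithful {X Y : C} (f : X ⟶ Y) (hf : π.map (F.T.map f) = 0) : π.map f = 0 := by
  obtain ⟨d, hd⟩ := ((hπ.map_eq_zero_iff _).1 hf).exists_lift_q
  obtain ⟨c, hc⟩ := F.exists_lift_ι (F.I.map f - F.q X ≫ d) (by
    rw [sub_comp, assoc, hd, F.q_naturality, sub_self])
  refine (hπ.map_eq_zero_iff _).2 ⟨X, F.ι X, c, ?_⟩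
  rw [← cancel_mono (F.ι Y), assoc, hc, comp_sub, F.ι_q_assoc, sub_zero,
    F.ι_naturality]

/-- A Schanuel comparison. `K ⟶ I K ⟶ T K` and `K ⟶ I W ⟶ W` begin at the same `K`, and each
embedding extends along the other; the induced maps between `T K` and `W` are inverse modulo null
maps. -/
lemma map_T_essSurj (W : C) : ∃ K : C, Nonempty (π.obj (F.T.obj K) ≅ π.obj W) := by
  let K := kernel (F.ε W)
  let k : K ⟶ F.I.obj W := kernel.ι (F.ε W)
  have hk : k ≫ F.ε W = 0 := kernel.condition _
  have hS : (ShortComplex.mk k (F.ε W) hk).Exact := ShortComplex.exact_kernel (F.ε W)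
  obtain ⟨g, hg⟩ : ∃ g, k ≫ g = F.ι K := F.exists_extension_kernel W
  obtain ⟨b, hb⟩ := F.exists_extension k
  obtain ⟨β, hβ⟩ := F.exists_desc_q (b ≫ F.ε W) (by rw [reassoc_of% hb, hk])
  obtain ⟨h, hh⟩ : ∃ h, F.ε W ≫ h = g ≫ F.q K :=
    ⟨hS.desc (g ≫ F.q K) (by dsimp; rw [reassoc_of% hg, F.ι_q]), hS.g_desc _ _⟩
  obtain ⟨d, hd⟩ : ∃ d, F.ε W ≫ d = g ≫ b - 𝟙 _ :=
    ⟨hS.desc (g ≫ b - 𝟙 _) (by dsimp; rw [comp_sub, reassoc_of% hg, hb, comp_id, sub_self]),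
      hS.g_desc _ _⟩
  obtain ⟨d', hd'⟩ := F.exists_desc_q (b ≫ g - 𝟙 _) (by
    rw [comp_sub, reassoc_of% hb, hg, comp_id, sub_self])
  refine ⟨K, ⟨⟨π.map β, π.map h, ?_, ?_⟩⟩⟩
  · rw [← π.map_comp, ← π.map_id]
    refine hπ.map_eq_map ⟨_, d', F.q K, ?_⟩
    rw [← cancel_epi (F.q K), reassoc_of% hd', comp_sub, reassoc_of% hβ, hh]
    simp
  · rw [← π.map_comp, ← π.map_id]
    refine hπ.map_eq_map ⟨_, d, F.ε W, ?_⟩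
    rw [← cancel_epi (F.ε W), reassoc_of% hd, comp_sub, reassoc_of% hh, hβ]
    simp

/-- A functor induced by `T` on the stable category is an equivalence. -/
lemma isEquivalence {T' : Q ⥤ Q} (θ : π ⋙ T' ≅ F.T ⋙ π) : T'.IsEquivalence := by
  have := hπ.additive
  have := hπ.full
  have := hπ.essSurj
  have key {X Y : C} (f : X ⟶ Y) :
      T'.map (π.map f) = θ.hom.app X ≫ π.map (F.T.map f) ≫ θ.inv.app Y := by
    simpa using (θ.hom.naturality_assoc f (θ.inv.app Y))
  -- On the image of `π`, additivity of `T'` is inherited from `T`; it reduces faithfulness to maps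
  -- killed by `T'`.
  have hadd {X Y : C} (f g : π.obj X ⟶ π.obj Y) : T'.map (f - g) = T'.map f - T'.map g := by
    obtain ⟨f, rfl⟩ := π.map_surjective f
    obtain ⟨g, rfl⟩ := π.map_surjective g
    rw [← π.map_sub, key, key, key, F.T.map_sub, π.map_sub, sub_comp, comp_sub]
  have hfaith {X Y : C} (f : π.obj X ⟶ π.obj Y) (hf : T'.map f = 0) : f = 0 := by
    obtain ⟨f, rfl⟩ := π.map_surjective f
    apply hπ.map_T_faithful
    rw [key] at hf
    rw [← cancel_epi (θ.hom.app X), ← cancel_mono (θ.inv.app Y), assoc, hf]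
    simp
  have hfull {X Y : C} (f : T'.obj (π.obj X) ⟶ T'.obj (π.obj Y)) : ∃ g, T'.map g = f := by
    obtain ⟨g, hg⟩ := π.map_surjective (θ.inv.app X ≫ f ≫ θ.hom.app Y)
    obtain ⟨a, ha⟩ := hπ.map_T_full g
    refine ⟨π.map a, ?_⟩
    rw [key, ha, hg]
    simp
  refine
    { faithful := ⟨fun {X Y f g} h => ?_⟩
      full := ⟨fun {X Y} f => ?_⟩
      essSurj := ⟨fun Y => ?_⟩ }
  · rw [← cancel_epi (π.objObjPreimageIso X).hom, ← cancel_mono (π.objObjPreimageIso Y).inv,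
      ← sub_eq_zero]
    apply hfaith
    rw [hadd, sub_eq_zero]
    simp [h]
  · obtain ⟨g, hg⟩ := hfull (T'.map (π.objObjPreimageIso X).hom ≫ f ≫
      T'.map (π.objObjPreimageIso Y).inv)
    refine ⟨(π.objObjPreimageIso X).inv ≫ g ≫ (π.objObjPreimageIso Y).hom, ?_⟩
    rw [T'.map_comp, T'.map_comp, hg]
    simp only [assoc, ← T'.map_comp, ← T'.map_comp_assoc, Iso.inv_hom_id, T'.map_id, comp_id,
      id_comp]
  · obtain ⟨K, ⟨i⟩⟩ := hπ.map_T_essSurj (π.objPreimage Y)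
    exact ⟨π.obj K, ⟨θ.app K ≪≫ i ≪≫ π.objObjPreimageIso Y⟩⟩

end IsStableQuotient

end Quotient

end RelativeFrobenius

end CategoryTheory

/-! ### Cones, rotation and completion of morphisms -/

namespace CategoryTheory

open Category Limits Pretriangulated Preadditive

universe v₁ v₂ u₁ u₂

namespace RelativeFrobenius

variable {C : Type u₁} [Category.{v₁} C] [Abelian C] {F : RelativeFrobenius C}
  {Q : Type u₂} [Category.{v₂} Q] {π : C ⥤ Q}

section

variable (F) {X Y : C} (u : X ⟶ Y)

/-- The cone of a morphism `u : X ⟶ Y`: the pushout of `u` along `X ⟶ I X`. -/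
noncomputable def cone : C := pushout u (F.ι X)

/-- The morphism from the target of `u` to the cone of `u`. -/
noncomputable def coneIn : Y ⟶ F.cone u := pushout.inl u (F.ι X)

/-- The morphism from `I X` to the cone of a morphism with source `X`. -/
noncomputable def coneInr : F.I.obj X ⟶ F.cone u := pushout.inr u (F.ι X)

variable {u} in
/-- The universal property of the cone. -/
noncomputable def coneDesc {W : C} (a : Y ⟶ W) (b : F.I.obj X ⟶ W) (h : u ≫ a = F.ι X ≫ b) :
    F.cone u ⟶ W := pushout.desc a b h

/-- The morphism from the cone of `u : X ⟶ Y` to `T X`. -/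
noncomputable def coneOut : F.cone u ⟶ F.T.obj X :=
  F.coneDesc 0 (F.q X) (by rw [comp_zero, ι_q])

lemma cone_condition : u ≫ F.coneIn u = F.ι X ≫ F.coneInr u := pushout.condition

lemma cone_condition_assoc {W : C} (f : F.cone u ⟶ W) :
    u ≫ F.coneIn u ≫ f = F.ι X ≫ F.coneInr u ≫ f := by
  rw [← assoc, cone_condition, assoc]

variable {u} in
lemma cone_hom_ext {W : C} {f g : F.cone u ⟶ W} (h₁ : F.coneIn u ≫ f = F.coneIn u ≫ g)
    (h₂ : F.coneInr u ≫ f = F.coneInr u ≫ g) : f = g := pushout.hom_ext h₁ h₂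

section

variable {W : C} (a : Y ⟶ W) (b : F.I.obj X ⟶ W) (h : u ≫ a = F.ι X ≫ b)

@[simp]
lemma coneIn_desc : F.coneIn u ≫ F.coneDesc a b h = a := pushout.inl_desc _ _ _

@[simp]
lemma coneIn_desc_assoc {W' : C} (f : W ⟶ W') :
    F.coneIn u ≫ F.coneDesc a b h ≫ f = a ≫ f := by
  rw [← assoc, coneIn_desc]

@[simp]
lemma coneInr_desc : F.coneInr u ≫ F.coneDesc a b h = b := pushout.inr_desc _ _ _

@[simp]
lemma coneInr_desc_assoc {W' : C} (f : W ⟶ W') :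
    F.coneInr u ≫ F.coneDesc a b h ≫ f = b ≫ f := by
  rw [← assoc, coneInr_desc]

end

@[simp]
lemma coneIn_out : F.coneIn u ≫ F.coneOut u = 0 := F.coneIn_desc _ _ _ _

@[simp]
lemma coneIn_out_assoc {W : C} (f : F.T.obj X ⟶ W) : F.coneIn u ≫ F.coneOut u ≫ f = 0 := by
  rw [← assoc, coneIn_out, zero_comp]

@[simp]
lemma coneInr_out : F.coneInr u ≫ F.coneOut u = F.q X := F.coneInr_desc _ _ _ _

@[simp]
lemma coneInr_out_assoc {W : C} (f : F.T.obj X ⟶ W) :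
    F.coneInr u ≫ F.coneOut u ≫ f = F.q X ≫ f := by
  rw [← assoc, coneInr_out]

instance : Epi (F.coneOut u) := by
  have : Epi (F.coneInr u ≫ F.coneOut u) := by rw [coneInr_out]; infer_instance
  exact epi_of_epi (F.coneInr u) _

/-- Pushing out along `u` does not change the cokernel of `ι X`. -/
lemma exact_coneIn_coneOut :
    (ShortComplex.mk (F.coneIn u) (F.coneOut u) (F.coneIn_out u)).Exact := by
  apply ShortComplex.exact_of_g_is_cokernel
  refine CokernelCofork.IsColimit.ofπ' _ _ (fun {W} f hf => ?_)
  dsimp at f hf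
  have h : F.ι X ≫ F.coneInr u ≫ f = 0 := by
    rw [← cone_condition_assoc, hf, comp_zero]
  refine ⟨(F.shortExact X).exact.desc _ h, F.cone_hom_ext ?_ ?_⟩
  · simp [hf]
  · dsimp
    rw [coneInr_out_assoc]
    exact (F.shortExact X).exact.g_desc _ h

end

variable [HasShift Q ℤ] (e : π ⋙ shiftFunctor Q (1 : ℤ) ≅ F.T ⋙ π)

/-- The shift of the image of `X` is the image of `T X`. -/
def shiftIso (X : C) : (π.obj X)⟦(1 : ℤ)⟧ ≅ π.obj (F.T.obj X) := e.app X

lemma shiftIso_hom_naturality {X Y : C} (f : X ⟶ Y) :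
    (π.map f)⟦(1 : ℤ)⟧' ≫ (shiftIso e Y).hom = (shiftIso e X).hom ≫ π.map (F.T.map f) :=
  e.hom.naturality f

lemma shiftIso_hom_naturality_assoc {X Y : C} (f : X ⟶ Y) {W : Q}
    (g : π.obj (F.T.obj Y) ⟶ W) : (π.map f)⟦(1 : ℤ)⟧' ≫ (shiftIso e Y).hom ≫ g =
      (shiftIso e X).hom ≫ π.map (F.T.map f) ≫ g := by
  rw [← assoc, shiftIso_hom_naturality, assoc]

lemma shiftIso_inv_naturality {X Y : C} (f : X ⟶ Y) :
    π.map (F.T.map f) ≫ (shiftIso e Y).inv = (shiftIso e X).inv ≫ (π.map f)⟦(1 : ℤ)⟧' :=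
  e.inv.naturality f

/-- The image in the stable category of the triangle `X ⟶ Y ⟶ C_u ⟶ T X`. -/
noncomputable def stdTriangle {X Y : C} (u : X ⟶ Y) : Triangle Q :=
  Triangle.mk (π.map u) (π.map (F.coneIn u)) (π.map (F.coneOut u) ≫ (shiftIso e X).inv)

/-- A triangle is distinguished if it is isomorphic to the image of some
`X ⟶ Y ⟶ C_u ⟶ T X`. -/
def Dist (t : Triangle Q) : Prop :=
  ∃ (X Y : C) (u : X ⟶ Y), Nonempty (t ≅ stdTriangle e u)

variable {e}

lemma Dist.of_iso {t t' : Triangle Q} (h : Dist e t) (i : t' ≅ t) : Dist e t' := by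
  obtain ⟨X, Y, u, ⟨j⟩⟩ := h
  exact ⟨X, Y, u, ⟨i ≪≫ j⟩⟩

/-- An isomorphism of triangles from the required data. -/
def triangleMkIso {X Y Z X' Y' Z' : Q} {f : X ⟶ Y} {g : Y ⟶ Z} {h : Z ⟶ X⟦(1 : ℤ)⟧}
    {f' : X' ⟶ Y'} {g' : Y' ⟶ Z'} {h' : Z' ⟶ X'⟦(1 : ℤ)⟧} (a : X ≅ X') (b : Y ≅ Y') (c : Z ≅ Z')
    (h₁ : f ≫ b.hom = a.hom ≫ f') (h₂ : g ≫ c.hom = b.hom ≫ g')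
    (h₃ : h ≫ a.hom⟦(1 : ℤ)⟧' = c.hom ≫ h') : Triangle.mk f g h ≅ Triangle.mk f' g' h' :=
  Triangle.isoMk _ _ a b c h₁ h₂ h₃

variable [Preadditive Q]

namespace IsStableQuotient

variable (hπ : F.IsStableQuotient π)

include hπ

/-- A right exact sequence `X ⟶ Y ⟶ Z` such that `X ⟶ I X` extends to `Y` gives
a distinguished triangle. -/
lemma dist_of_exact {X Y Z : C} {i : X ⟶ Y} {p : Y ⟶ Z} (w : i ≫ p = 0)
    (hS : (ShortComplex.mk i p w).Exact) [Epi p] {g : Y ⟶ F.I.obj X} (hg : i ≫ g = F.ι X)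
    {h : Z ⟶ F.T.obj X} (hh : p ≫ h = g ≫ F.q X) :
    Dist e (Triangle.mk (π.map i) (π.map p) (-(π.map h ≫ (shiftIso e X).inv))) := by
  have := hπ.additive
  -- The map `c` collapses `I X`. Its stable inverse `c'` is an exact section, and `𝟙 - c ≫ c'` is
  -- `ρ ≫ coneInr`, which factors through `I X`.
  let c : F.cone i ⟶ Z := F.coneDesc p 0 (by rw [w, comp_zero])
  let ρ : F.cone i ⟶ F.I.obj X := F.coneDesc g (𝟙 _) (by rw [hg, comp_id])
  obtain ⟨c', hc'⟩ : ∃ c', p ≫ c' = F.coneIn i - g ≫ F.coneInr i :=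
    ⟨hS.desc (F.coneIn i - g ≫ F.coneInr i)
      (by dsimp; rw [comp_sub, reassoc_of% hg, cone_condition, sub_self]), hS.g_desc _ _⟩
  let φ : π.obj Z ≅ π.obj (F.cone i) :=
    { hom := π.map c'
      inv := π.map c
      hom_inv_id := by
        rw [← π.map_comp, ← π.map_id]
        congr 1
        rw [← cancel_epi p, reassoc_of% hc', sub_comp, assoc]
        simp [c]
      inv_hom_id := by
        symm
        rw [← π.map_comp, ← π.map_id]
        refine hπ.map_eq_map ⟨X, ρ, F.coneInr i, F.cone_hom_ext ?_ ?_⟩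
        · simp [ρ, c, hc']
        · simp [ρ, c] }
  refine ⟨X, Y, i, ⟨(triangleMkIso (Iso.refl _) (Iso.refl _) φ.symm ?_ ?_ ?_).symm⟩⟩
  · simp
  · rw [Iso.refl_hom, id_comp]
    exact (π.map_comp _ _).symm.trans (congrArg π.map (F.coneIn_desc _ _ _ _))
  -- The sign appears because the sum `coneOut + c ≫ h`, not the difference, equals the null map `ρ
  -- ≫ q`.
  · have : π.map (F.coneOut i) = - π.map (c ≫ h) := by
      rw [eq_neg_iff_add_eq_zero, ← π.map_add, hπ.map_eq_zero_iff]
      refine ⟨X, ρ, F.q X, F.cone_hom_ext ?_ ?_⟩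
      · simp [ρ, c, hh]
      · simp [ρ, c]
    simp [φ, this]

/-- The embedding `ι Y` extends to the cone by `I u` on `I X`, and induces `T u` on cokernels; the
sign of `dist_of_exact` is the sign of the rotation. -/
lemma dist_rotate_stdTriangle [(shiftFunctor Q (1 : ℤ)).Additive] {X Y : C} (u : X ⟶ Y) :
    Dist e (stdTriangle e u).rotate := by
  change Dist e (Triangle.mk (π.map (F.coneIn u)) (π.map (F.coneOut u) ≫ (shiftIso e X).inv)
    (-(π.map u)⟦(1 : ℤ)⟧'))
  let g : F.cone u ⟶ F.I.obj Y := F.coneDesc (F.ι Y) (F.I.map u) (F.ι_naturality u)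
  refine (hπ.dist_of_exact (e := e) (F.coneIn_out u) (F.exact_coneIn_coneOut u) (g := g)
    (F.coneIn_desc _ _ _ _) (h := F.T.map u) (F.cone_hom_ext ?_ ?_)).of_iso
    (triangleMkIso (Iso.refl _) (Iso.refl _) (shiftIso e X) ?_ ?_ ?_)
  · simp [g]
  · simp [g, F.q_naturality]
  · simp
  · simp
  · rw [comp_neg, ← shiftIso_hom_naturality_assoc]
    simp

lemma dist_rotate [(shiftFunctor Q (1 : ℤ)).Additive] {t : Triangle Q} (ht : Dist e t) :
    Dist e t.rotate := by
  obtain ⟨X, Y, u, ⟨i⟩⟩ := ht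
  exact (hπ.dist_rotate_stdTriangle u).of_iso ((rotate Q).mapIso i)

lemma dist_contractible [HasZeroObject Q] (X : Q) : Dist e (contractibleTriangle X) := by
  have := hπ.essSurj
  let X' := π.objPreimage X
  let i := π.objObjPreimageIso X
  have hz : IsZero (π.obj (F.cone (𝟙 X'))) := by
    have : IsIso (F.coneInr (𝟙 X')) := by dsimp [coneInr, cone]; infer_instance
    exact (hπ.isZero_obj_I X').of_iso (π.mapIso (asIso (F.coneInr (𝟙 X')))).symm
  refine ⟨X', X', 𝟙 X', ⟨triangleMkIso i.symm i.symm ((isZero_zero _).iso hz) ?_ ?_ ?_⟩⟩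
  · rw [π.map_id, id_comp]
    exact (comp_id _).symm
  · exact hz.eq_of_tgt _ _
  · exact (isZero_zero Q).eq_of_src _ _

lemma exists_dist {X Y : Q} (f : X ⟶ Y) :
    ∃ (Z : Q) (g : Y ⟶ Z) (h : Z ⟶ X⟦(1 : ℤ)⟧), Dist e (Triangle.mk f g h) := by
  have := hπ.essSurj
  have := hπ.full
  let i := π.objObjPreimageIso X
  let j := π.objObjPreimageIso Y
  obtain ⟨u, hu⟩ := π.map_surjective (i.hom ≫ f ≫ j.inv)
  refine ⟨_, j.inv ≫ π.map (F.coneIn u),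
    π.map (F.coneOut u) ≫ (shiftIso e _).inv ≫ i.hom⟦1⟧',
    _, _, u, ⟨triangleMkIso i.symm j.symm (Iso.refl _) ?_ ?_ ?_⟩⟩
  · rw [hu]
    exact (i.inv_hom_id_assoc _).symm
  · simp
  · simp [← Functor.map_comp]

lemma exists_completion_std {X Y X' Y' : C} (u : X ⟶ Y) (u' : X' ⟶ Y')
    (a : π.obj X ⟶ π.obj X') (b : π.obj Y ⟶ π.obj Y') (h : π.map u ≫ b = a ≫ π.map u') :
    ∃ c : π.obj (F.cone u) ⟶ π.obj (F.cone u'),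
      π.map (F.coneIn u) ≫ c = b ≫ π.map (F.coneIn u') ∧
      (π.map (F.coneOut u) ≫ (shiftIso e X).inv) ≫ a⟦1⟧' =
        c ≫ π.map (F.coneOut u') ≫ (shiftIso e X').inv := by
  have := hπ.full
  obtain ⟨a, rfl⟩ := π.map_surjective a
  obtain ⟨b, rfl⟩ := π.map_surjective b
  rw [← π.map_comp, ← π.map_comp] at h
  obtain ⟨c, hc⟩ := (hπ.null_sub h).exists_factor
  -- The square commutes only up to the homotopy `c`, which corrects the component on `I X` of the
  -- map of cones.
  have hd : u ≫ b ≫ F.coneIn u' = F.ι X ≫ (F.I.map a ≫ F.coneInr u' + c ≫ F.coneIn u') := by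
    rw [comp_add, reassoc_of% hc, ← F.ι_naturality_assoc, ← cone_condition, sub_comp]
    simp
  refine ⟨π.map (F.coneDesc _ _ hd), ?_, ?_⟩
  · rw [← π.map_comp, ← π.map_comp, coneIn_desc]
  · rw [assoc, ← shiftIso_inv_naturality, ← π.map_comp_assoc, ← π.map_comp_assoc]
    congr 2
    refine F.cone_hom_ext ?_ ?_
    · simp
    · simp [F.q_naturality]

lemma exists_completion_stdTriangle {X Y X' Y' : C} (u : X ⟶ Y) (u' : X' ⟶ Y')
    (a : (stdTriangle e u).obj₁ ⟶ (stdTriangle e u').obj₁)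
    (b : (stdTriangle e u).obj₂ ⟶ (stdTriangle e u').obj₂)
    (h : (stdTriangle e u).mor₁ ≫ b = a ≫ (stdTriangle e u').mor₁) :
    ∃ c : (stdTriangle e u).obj₃ ⟶ (stdTriangle e u').obj₃,
      (stdTriangle e u).mor₂ ≫ c = b ≫ (stdTriangle e u').mor₂ ∧
      (stdTriangle e u).mor₃ ≫ a⟦1⟧' = c ≫ (stdTriangle e u').mor₃ :=
  hπ.exists_completion_std u u' a b h

lemma exists_completion {t t' : Triangle Q} (ht : Dist e t) (ht' : Dist e t')
    (a : t.obj₁ ⟶ t'.obj₁) (b : t.obj₂ ⟶ t'.obj₂) (h : t.mor₁ ≫ b = a ≫ t'.mor₁) :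
    ∃ c : t.obj₃ ⟶ t'.obj₃, t.mor₂ ≫ c = b ≫ t'.mor₂ ∧ t.mor₃ ≫ a⟦1⟧' = c ≫ t'.mor₃ := by
  obtain ⟨X, Y, u, ⟨i⟩⟩ := ht
  obtain ⟨X', Y', u', ⟨i'⟩⟩ := ht'
  obtain ⟨c, hc, hc'⟩ := hπ.exists_completion_stdTriangle u u'
    (i.inv.hom₁ ≫ a ≫ i'.hom.hom₁) (i.inv.hom₂ ≫ b ≫ i'.hom.hom₂) (by
      rw [i.inv.comm₁_assoc, reassoc_of% h, i'.hom.comm₁, assoc, assoc])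
  refine ⟨i.hom.hom₃ ≫ c ≫ i'.inv.hom₃, ?_, ?_⟩
  · rw [i.hom.comm₂_assoc, reassoc_of% hc]
    simp
  · simp only [assoc]
    rw [← i'.inv.comm₃, ← reassoc_of% hc', ← i.hom.comm₃_assoc, ← Functor.map_comp,
      ← Functor.map_comp]
    simp

end IsStableQuotient

end RelativeFrobenius

end CategoryTheory

/-! ### Inverse rotation and the octahedral axiom -/

namespace CategoryTheory

open Category Limits Pretriangulated Preadditive

universe v₁ v₂ u₁ u₂

namespace RelativeFrobenius

namespace IsStableQuotient

variable {C : Type u₁} [Category.{v₁} C] [Abelian C] {F : RelativeFrobenius C}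
  {Q : Type u₂} [Category.{v₂} Q] [Preadditive Q] {π : C ⥤ Q} (hπ : F.IsStableQuotient π)

include hπ

lemma exists_desc_coneIn {X Y : C} (u : X ⟶ Y) {W : Q} (f : π.obj Y ⟶ W)
    (h : π.map u ≫ f = 0) : ∃ a : π.obj (F.cone u) ⟶ W, π.map (F.coneIn u) ≫ a = f := by
  have := hπ.full
  have := hπ.essSurj
  let i := π.objObjPreimageIso W
  obtain ⟨f', hf'⟩ := π.map_surjective (f ≫ i.inv)
  have h' : π.map (u ≫ f') = 0 := by rw [π.map_comp, hf', reassoc_of% h, zero_comp]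
  obtain ⟨c, hc⟩ := ((hπ.map_eq_zero_iff _).1 h').exists_factor
  exact ⟨π.map (F.coneDesc f' c hc.symm) ≫ i.hom, by
    rw [← π.map_comp_assoc, coneIn_desc, hf', assoc, i.inv_hom_id, comp_id]⟩

/-- For a morphism `v : Y ⟶ Z`, the morphism `(v, ι) : Y ⟶ Z ⊞ I Y` has stable class `v`. -/
lemma exists_replacement {Y Z : C} (v : Y ⟶ Z) :
    ∃ (Z' : C) (j : Y ⟶ Z') (g : Z' ⟶ F.I.obj Y) (p : Z' ⟶ Z),
      j ≫ g = F.ι Y ∧ j ≫ p = v ∧ IsIso (π.map p) := by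
  have := hπ.additive
  -- The summand `I Y` is stably zero, and its projection extends `ι Y`, as `dist_of_exact`
  -- requires.
  refine ⟨Z ⊞ F.I.obj Y, biprod.lift v (F.ι Y), biprod.snd, biprod.fst, by simp, by simp,
    π.map biprod.inl, ?_, ?_⟩
  · rw [← π.map_comp, ← π.map_id]
    symm
    refine hπ.map_eq_map ⟨Y, biprod.snd, biprod.inr, ?_⟩
    rw [eq_sub_iff_add_eq, add_comm, biprod.total]
  · rw [← π.map_comp, biprod.inl_fst, π.map_id]

variable [HasShift Q ℤ] {e : π ⋙ shiftFunctor Q (1 : ℤ) ≅ F.T ⋙ π}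

lemma exists_desc_stdTriangle {X Y : C} (u : X ⟶ Y) {W : Q} (f : (stdTriangle e u).obj₂ ⟶ W)
    (h : (stdTriangle e u).mor₁ ≫ f = 0) :
    ∃ a : (stdTriangle e u).obj₃ ⟶ W, (stdTriangle e u).mor₂ ≫ a = f :=
  hπ.exists_desc_coneIn u f h

/-- The second morphism of a distinguished triangle is a weak cokernel of the first one. -/
lemma exists_desc {t : Triangle Q} (ht : Dist e t) {W : Q} (f : t.obj₂ ⟶ W)
    (h : t.mor₁ ≫ f = 0) : ∃ a : t.obj₃ ⟶ W, t.mor₂ ≫ a = f := by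
  obtain ⟨X, Y, u, ⟨i⟩⟩ := ht
  obtain ⟨a, ha⟩ := hπ.exists_desc_stdTriangle u (i.inv.hom₂ ≫ f) (by
    rw [i.inv.comm₁_assoc, h, comp_zero])
  exact ⟨i.hom.hom₃ ≫ a, by rw [i.hom.comm₂_assoc, ha]; simp⟩

/-- Since `α - 𝟙` factors through `mor₃` and `α` fixes `mor₃`, `(α - 𝟙)² = 0`; so `2 - α` is inverse
to `α`. -/
lemma isIso_of_comp_eq {t : Triangle Q} (ht : Dist e t.rotate) (α : t.obj₃ ⟶ t.obj₃)
    (h₂ : t.mor₂ ≫ α = t.mor₂) (h₃ : α ≫ t.mor₃ = t.mor₃) : IsIso α := by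
  obtain ⟨a, ha⟩ : ∃ a, t.mor₃ ≫ a = α - 𝟙 _ :=
    hπ.exists_desc ht (α - 𝟙 _) (by
      change t.mor₂ ≫ (α - 𝟙 _) = 0
      rw [comp_sub, h₂, comp_id, sub_self])
  have hα : α ≫ (α - 𝟙 _) = α - 𝟙 _ := by rw [← ha, reassoc_of% h₃]
  have hα' : α ≫ α = α - 𝟙 _ + α := by rw [← hα]; simp
  refine ⟨𝟙 _ + 𝟙 _ - α, ?_, ?_⟩
  · rw [comp_sub, comp_add, comp_id, hα']
    abel
  · rw [sub_comp, add_comp, id_comp, hα']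
    abel

/-- Two further rotations give distinguished triangles with the same first map `-f⟦1⟧'`. Completing
the identities gives a map `Z⟦1⟧ ⟶ Z'⟦1⟧`, which desuspends as the shift is fully faithful. -/
lemma exists_hom_of_rotate {X Y Z Z' : Q} {f : X ⟶ Y} {g : Y ⟶ Z} {h : Z ⟶ X⟦(1 : ℤ)⟧}
    {g' : Y ⟶ Z'} {h' : Z' ⟶ X⟦(1 : ℤ)⟧} [(shiftFunctor Q (1 : ℤ)).Additive]
    (ht : Dist e (Triangle.mk f g h).rotate) (ht' : Dist e (Triangle.mk f g' h').rotate) :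
    ∃ γ : Z ⟶ Z', g ≫ γ = g' ∧ γ ≫ h' = h := by
  obtain ⟨c, hc, hc'⟩ : ∃ c : Z⟦(1 : ℤ)⟧ ⟶ Z'⟦(1 : ℤ)⟧,
      (-g⟦(1 : ℤ)⟧') ≫ c = 𝟙 _ ≫ (-g'⟦(1 : ℤ)⟧') ∧
      (-h⟦(1 : ℤ)⟧') ≫ (𝟙 (X⟦(1 : ℤ)⟧))⟦(1 : ℤ)⟧' = c ≫ (-h'⟦(1 : ℤ)⟧') :=
    hπ.exists_completion (hπ.dist_rotate (hπ.dist_rotate ht))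
      (hπ.dist_rotate (hπ.dist_rotate ht')) (𝟙 (X⟦(1 : ℤ)⟧)) (𝟙 (Y⟦(1 : ℤ)⟧))
      ((comp_id _).trans (id_comp _).symm)
  obtain ⟨γ, rfl⟩ := (shiftFunctor Q (1 : ℤ)).map_surjective c
  refine ⟨γ, (shiftFunctor Q (1 : ℤ)).map_injective ?_,
    (shiftFunctor Q (1 : ℤ)).map_injective ?_⟩
  · simpa using hc
  · simpa using hc'.symm

/-- Compare with a distinguished triangle on the same `f`: there are maps both ways, and their
composites are unipotent. -/
lemma dist_of_dist_rotate [(shiftFunctor Q (1 : ℤ)).Additive] {t : Triangle Q}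
    (ht : Dist e t.rotate) : Dist e t := by
  obtain ⟨X, Y, Z, f, g, h⟩ := t
  change Dist e (Triangle.mk f g h).rotate at ht
  change Dist e (Triangle.mk f g h)
  obtain ⟨Z', g', h', ht'⟩ := hπ.exists_dist (e := e) f
  have ht'' := hπ.dist_rotate ht'
  obtain ⟨γ, hγ₁, hγ₂⟩ := hπ.exists_hom_of_rotate ht ht''
  obtain ⟨γ', hγ₁', hγ₂'⟩ := hπ.exists_hom_of_rotate ht'' ht
  have h₁ : IsIso (γ ≫ γ') := hπ.isIso_of_comp_eq ht (γ ≫ γ')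
    (show g ≫ γ ≫ γ' = g by rw [reassoc_of% hγ₁, hγ₁'])
    (show (γ ≫ γ') ≫ h = h by rw [assoc, hγ₂', hγ₂])
  have h₂ : IsIso (γ' ≫ γ) := hπ.isIso_of_comp_eq ht'' (γ' ≫ γ)
    (show g' ≫ γ' ≫ γ = g' by rw [reassoc_of% hγ₁', hγ₁])
    (show (γ' ≫ γ) ≫ h' = h' by rw [assoc, hγ₂, hγ₂'])
  have : Mono γ := mono_of_mono γ γ'
  have : IsSplitEpi γ := ⟨⟨inv (γ' ≫ γ) ≫ γ', by simp⟩⟩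
  have : IsIso γ := isIso_of_mono_of_isSplitEpi γ
  exact ht'.of_iso (triangleMkIso (Iso.refl _) (Iso.refl _) (asIso γ) (by simp) (by simp [hγ₁])
    (by simp [hγ₂]))

variable (e) in
/-- The pretriangulated structure on the stable category. -/
@[reducible]
def pretriangulated [HasZeroObject Q] [∀ n : ℤ, (shiftFunctor Q n).Additive] :
    Pretriangulated Q where
  distinguishedTriangles := {t | Dist e t}
  isomorphic_distinguished _ h _ i := Dist.of_iso h i
  contractible_distinguished X := hπ.dist_contractible X
  distinguished_cocone_triangle f := hπ.exists_dist f
  rotate_distinguished_triangle _ := ⟨hπ.dist_rotate, hπ.dist_of_dist_rotate⟩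
  complete_distinguished_triangle_morphism _ _ h h' a b w := hπ.exists_completion h h' a b w

end IsStableQuotient

/-- The right exact part of the third isomorphism theorem; `i` and `j` need not be monomorphisms. -/
lemma exact_cokernel_desc {C : Type u₁} [Category.{v₁} C] [Abelian C] {X Y Z : C}
    (i : X ⟶ Y) (j : Y ⟶ Z) :
    (ShortComplex.mk (cokernel.desc i (j ≫ cokernel.π (i ≫ j))
        (by rw [← assoc, cokernel.condition]))
      (cokernel.desc (i ≫ j) (cokernel.π j) (by simp)) (by ext; simp)).Exact := by
  apply ShortComplex.exact_of_g_is_cokernel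
  refine CokernelCofork.IsColimit.ofπ' _ _ (fun {W} f hf => ?_)
  dsimp at f hf
  have h : j ≫ cokernel.π (i ≫ j) ≫ f = 0 := by
    have := cokernel.π i ≫= hf
    simpa using this
  exact ⟨cokernel.desc j _ h, by ext; simp⟩

namespace IsStableQuotient

variable {C : Type u₁} [Category.{v₁} C] [Abelian C] {F : RelativeFrobenius C}
  {Q : Type u₂} [Category.{v₂} Q] [Preadditive Q] {π : C ⥤ Q} [HasShift Q ℤ]
  {e : π ⋙ shiftFunctor Q (1 : ℤ) ≅ F.T ⋙ π} (hπ : F.IsStableQuotient π)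

include hπ

lemma isTriangulated [HasZeroObject Q] [∀ n : ℤ, (shiftFunctor Q n).Additive] :
    letI := hπ.pretriangulated e
    IsTriangulated Q := by
  let := hπ.pretriangulated e
  have := hπ.additive
  have := hπ.full
  have := hπ.essSurj
  refine IsTriangulated.mk' (fun X₁ X₂ X₃ u₁₂ u₂₃ => ?_)
  let X := π.objPreimage X₁
  obtain ⟨u, hu⟩ := π.map_surjective
    ((π.objObjPreimageIso X₁).hom ≫ u₁₂ ≫ (π.objObjPreimageIso X₂).inv)
  obtain ⟨Y, i, g₀, s, hg₀, rfl, hs⟩ := hπ.exists_replacement u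
  obtain ⟨v, hv⟩ := π.map_surjective
    (π.map s ≫ (π.objObjPreimageIso X₂).hom ≫ u₂₃ ≫ (π.objObjPreimageIso X₃).inv)
  obtain ⟨Z, j, g', s', hg', rfl, hs'⟩ := hπ.exists_replacement v
  -- Extending `g₀` along `Y ⟶ I Y` makes `g` an extension of `ι X` along `i ≫ j` that is compatible
  -- with `g₀`.
  obtain ⟨g₁, hg₁⟩ := F.exists_extension g₀
  let g := g' ≫ g₁
  have hg : j ≫ g = g₀ := by rw [← hg₁, ← hg', assoc]
  obtain ⟨h₁₂, hh₁₂⟩ : ∃ h, cokernel.π i ≫ h = g₀ ≫ F.q X :=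
    ⟨cokernel.desc i (g₀ ≫ F.q X) (by rw [reassoc_of% hg₀, ι_q]), by simp⟩
  obtain ⟨h₁₃, hh₁₃⟩ : ∃ h, cokernel.π (i ≫ j) ≫ h = g ≫ F.q X :=
    ⟨cokernel.desc (i ≫ j) (g ≫ F.q X) (by rw [assoc, reassoc_of% hg, reassoc_of% hg₀, ι_q]),
      by simp⟩
  obtain ⟨h₂₃, hh₂₃⟩ : ∃ h, cokernel.π j ≫ h = g' ≫ F.q Y :=
    ⟨cokernel.desc j (g' ≫ F.q Y) (by rw [reassoc_of% hg', ι_q]), by simp⟩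
  let m₁ : cokernel i ⟶ cokernel (i ≫ j) := cokernel.desc i (j ≫ cokernel.π (i ≫ j))
        (by rw [← assoc, cokernel.condition])
  let m₃ : cokernel (i ≫ j) ⟶ cokernel j := cokernel.desc (i ≫ j) (cokernel.π j) (by simp)
  have hm₁ : cokernel.π i ≫ m₁ = j ≫ cokernel.π (i ≫ j) := cokernel.π_desc _ _ _
  have hm₃ : cokernel.π (i ≫ j) ≫ m₃ = cokernel.π j := cokernel.π_desc _ _ _
  have : Epi m₃ := epi_of_epi_fac hm₃
  -- `k` extends the embedding of `cokernel i` along `m₁`, so the sequence of cokernels also gives a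
  -- distinguished triangle.
  obtain ⟨k, hk⟩ : ∃ k, cokernel.π (i ≫ j) ≫ k = g' ≫ F.I.map (cokernel.π i) :=
    ⟨cokernel.desc (i ≫ j) (g' ≫ F.I.map (cokernel.π i)) (by
      rw [assoc, reassoc_of% hg', ← F.ι_naturality, cokernel.condition_assoc, zero_comp]),
      by simp⟩
  have d₁₂ := hπ.dist_of_exact (e := e) (cokernel.condition i)
    (ShortComplex.exact_cokernel i) hg₀ hh₁₂
  have d₂₃ := hπ.dist_of_exact (e := e) (cokernel.condition j)
    (ShortComplex.exact_cokernel j) hg' hh₂₃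
  have d₁₃ := hπ.dist_of_exact (e := e) (cokernel.condition (i ≫ j))
    (ShortComplex.exact_cokernel (i ≫ j)) (by rw [assoc, hg, hg₀]) hh₁₃
  have d := hπ.dist_of_exact (e := e) _ (exact_cokernel_desc i j) (g := k)
    (h := h₂₃ ≫ F.T.map (cokernel.π i)) (by
      rw [← cancel_epi (cokernel.π i), reassoc_of% hm₁, hk, reassoc_of% hg', F.ι_naturality]) (by
      change m₃ ≫ _ = _
      rw [← cancel_epi (cokernel.π (i ≫ j)), reassoc_of% hm₃, reassoc_of% hh₂₃, reassoc_of% hk,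
        F.q_naturality])
  rw [π.map_comp] at d₁₃
  -- The only octahedral relation that holds merely up to homotopy: the difference is `l ≫ q Y`.
  have comm₄ : π.map (h₁₃ ≫ F.T.map i) = π.map (m₃ ≫ h₂₃) := by
    obtain ⟨l, hl⟩ : ∃ l, cokernel.π (i ≫ j) ≫ l = g ≫ F.I.map i - g' :=
      ⟨cokernel.desc (i ≫ j) (g ≫ F.I.map i - g') (by
        rw [assoc, comp_sub, comp_sub, reassoc_of% hg, reassoc_of% hg₀, hg', F.ι_naturality,
          sub_self]), by simp⟩
    refine hπ.map_eq_map ⟨_, l, F.q Y, ?_⟩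
    rw [← cancel_epi (cokernel.π (i ≫ j)), reassoc_of% hl, comp_sub, reassoc_of% hh₁₃,
      reassoc_of% hm₃, hh₂₃, sub_comp, assoc, F.q_naturality]
  refine ⟨_, _, _, _, _, _, π.map i, π.map j, (π.objObjPreimageIso X₁).symm,
    (π.objObjPreimageIso X₂).symm ≪≫ (asIso (π.map s)).symm,
    (π.objObjPreimageIso X₃).symm ≪≫ (asIso (π.map s')).symm, ?_, ?_,
    _, _, d₁₂, _, _, d₂₃, _, _, d₁₃, ⟨⟨π.map m₁, π.map m₃, ?_, ?_, ?_, ?_, ?_⟩⟩⟩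
  · rw [← cancel_mono (π.map s)]
    simpa using ((π.objObjPreimageIso X₁).inv ≫= hu).symm
  · rw [← cancel_mono (π.map s')]
    simpa using ((π.objObjPreimageIso X₂).inv ≫= (inv (π.map s) ≫= hv)).symm
  · rw [← π.map_comp, hm₁, π.map_comp]
  · rw [comp_neg, ← π.map_comp_assoc]
    congr 3
    rw [← cancel_epi (cokernel.π i), reassoc_of% hm₁, hh₁₃, hh₁₂, reassoc_of% hg]
  · rw [← π.map_comp, hm₃]
  · rw [neg_comp, comp_neg, assoc, ← shiftIso_inv_naturality, ← π.map_comp_assoc,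
      ← π.map_comp_assoc, comm₄]
  · rw [neg_comp, assoc, ← shiftIso_inv_naturality, ← π.map_comp_assoc]
    exact d

end IsStableQuotient

end RelativeFrobenius

end CategoryTheory

/-! ### The Galois map and nondegeneracy of the integral -/

namespace Hopfological

open TensorProduct Coalgebra HopfAlgebra

universe u v

variable {k : Type u} {H : Type v} [Field k] [Ring H] [HopfAlgebra k H]

section Galois

variable (k H)

/-- The Galois map `a ⊗ b ↦ a₁ ⊗ a₂ b` of a Hopf algebra. -/
noncomputable def galoisMap : H ⊗[k] H →ₗ[k] H ⊗[k] H :=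
  (LinearMap.mul' k H).lTensor H ∘ₗ (TensorProduct.assoc k H H H).toLinearMap ∘ₗ comul.rTensor H

/-- The inverse `a ⊗ b ↦ a₁ ⊗ S(a₂) b` of the Galois map. -/
noncomputable def galoisInv : H ⊗[k] H →ₗ[k] H ⊗[k] H :=
  (LinearMap.mul' k H ∘ₗ (antipode k).rTensor H).lTensor H ∘ₗ
    (TensorProduct.assoc k H H H).toLinearMap ∘ₗ comul.rTensor H

variable {k H}

lemma galoisMap_tmul (a b : H) : galoisMap k H (a ⊗ₜ b) = comul a * (1 ⊗ₜ[k] b) := by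
  simp only [galoisMap, LinearMap.comp_apply, LinearMap.rTensor_tmul]
  induction (comul a : H ⊗[k] H) using TensorProduct.induction_on with
  | zero => simp
  | add x y hx hy => simp only [add_mul, add_tmul, map_add, hx, hy]
  | tmul x y => simp

lemma galoisInv_tmul (a b : H) :
    galoisInv k H (a ⊗ₜ b) = (antipode k).lTensor H (comul a) * (1 ⊗ₜ[k] b) := by
  simp only [galoisInv, LinearMap.comp_apply, LinearMap.rTensor_tmul]
  induction (comul a : H ⊗[k] H) using TensorProduct.induction_on with
  | zero => simp
  | add x y hx hy => simp only [add_mul, add_tmul, map_add, hx, hy]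
  | tmul x y => simp

/-- The Galois map intertwines multiplication on the first factor with the diagonal action. -/
lemma galoisMap_mul (h : H) (z : H ⊗[k] H) :
    galoisMap k H ((h ⊗ₜ 1) * z) = comul h * galoisMap k H z := by
  induction z using TensorProduct.induction_on with
  | zero => simp
  | add x y hx hy => simp only [mul_add, map_add, hx, hy]
  | tmul x y => simp [galoisMap_tmul, Bialgebra.comul_mul, mul_assoc]

lemma galoisInv_galoisMap (z : H ⊗[k] H) : galoisInv k H (galoisMap k H z) = z := by
  induction z using TensorProduct.induction_on with
  | zero => simp
  | add x y hx hy => simp only [map_add, hx, hy]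
  | tmul a b =>
    have key (w : H ⊗[k] H) : galoisInv k H (w * (1 ⊗ₜ b)) =
        (LinearMap.mul' k H ∘ₗ (antipode k).rTensor H).lTensor H
          (TensorProduct.assoc k H H H (comul.rTensor H w)) * (1 ⊗ₜ b) := by
      induction w using TensorProduct.induction_on with
      | zero => simp
      | add x y hx hy => simp only [add_mul, map_add, hx, hy]
      | tmul x y =>
        simp only [Algebra.TensorProduct.tmul_mul_tmul, mul_one, galoisInv_tmul,
          LinearMap.rTensor_tmul]
        induction (comul x : H ⊗[k] H) using TensorProduct.induction_on with
        | zero => simp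
        | add x y hx hy => simp only [add_mul, add_tmul, map_add, hx, hy]
        | tmul x y => simp [mul_assoc]
    rw [galoisMap_tmul, key, coassoc_apply, ← LinearMap.lTensor_comp_apply,
      LinearMap.comp_assoc, mul_antipode_rTensor_comul, LinearMap.lTensor_comp_apply,
      lTensor_counit_comul]
    simp

lemma galoisMap_galoisInv [FiniteDimensional k H] (z : H ⊗[k] H) :
    galoisMap k H (galoisInv k H z) = z := by
  -- In finite dimension a one-sided inverse of an endomorphism is two-sided.
  have h : galoisInv k H * galoisMap k H = 1 := LinearMap.ext galoisInv_galoisMap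
  exact LinearMap.congr_fun (mul_eq_one_comm.1 h) z

lemma galoisInv_comul_mul [FiniteDimensional k H] (h : H) (z : H ⊗[k] H) :
    galoisInv k H (comul h * z) = (h ⊗ₜ 1) * galoisInv k H z := by
  conv_lhs => rw [← galoisMap_galoisInv z, ← galoisMap_mul, galoisInv_galoisMap]

/-- The map `H ⊗ H → H` given by `a ⊗ b ↦ φ(S(a₂) b) a₁`. -/
noncomputable def contraction (φ : H →ₗ[k] k) : H ⊗[k] H →ₗ[k] H :=
  (TensorProduct.rid k H).toLinearMap ∘ₗ φ.lTensor H ∘ₗ galoisInv k H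

lemma contraction_comul_mul [FiniteDimensional k H] (φ : H →ₗ[k] k) (h : H) (z : H ⊗[k] H) :
    contraction φ (comul h * z) = h * contraction φ z := by
  simp only [contraction, LinearMap.comp_apply, galoisInv_comul_mul]
  induction galoisInv k H z using TensorProduct.induction_on with
  | zero => simp
  | add x y hx hy => simp only [mul_add, map_add, hx, hy]
  | tmul x y => simp

end Galois

namespace LeftIntegral

variable (Λ : LeftIntegral k H)

lemma comul_mul_tmul_elt (h : H) : comul h * (1 ⊗ₜ[k] Λ.elt) = h ⊗ₜ[k] Λ.elt := by
  have key (w : H ⊗[k] H) : w * (1 ⊗ₜ[k] Λ.elt) =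
      (TensorProduct.rid k H (counit.lTensor H w)) ⊗ₜ[k] Λ.elt := by
    induction w using TensorProduct.induction_on with
    | zero => simp
    | add x y hx hy => simp only [add_mul, map_add, add_tmul, hx, hy]
    | tmul x y => simp [Λ.mul_elt, smul_tmul]
  rw [key, lTensor_counit_comul]
  simp

lemma comul_mul_elt_tmul (h b : H) : comul h * (Λ.elt ⊗ₜ[k] b) = Λ.elt ⊗ₜ[k] (h * b) := by
  have key (w : H ⊗[k] H) : w * (Λ.elt ⊗ₜ[k] b) =
      Λ.elt ⊗ₜ[k] (TensorProduct.lid k H (counit.rTensor H w) * b) := by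
    induction w using TensorProduct.induction_on with
    | zero => simp
    | add x y hx hy => simp only [add_mul, map_add, tmul_add, hx, hy]
    | tmul x y => simp [Λ.mul_elt, smul_tmul]
  rw [key, rTensor_counit_comul]
  simp

/-- Since `h₁ ⊗ h₂ Λ = h ⊗ Λ`, the Galois map and its inverse fix `h ⊗ Λ`. -/
lemma contraction_tmul_elt (φ : H →ₗ[k] k) (h : H) :
    contraction φ (h ⊗ₜ Λ.elt) = φ Λ.elt • h := by
  have : galoisInv k H (h ⊗ₜ Λ.elt) = h ⊗ₜ Λ.elt := by
    conv_lhs => rw [← Λ.comul_mul_tmul_elt, ← galoisMap_tmul, galoisInv_galoisMap]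
  simp [contraction, this]

lemma contraction_elt_tmul [FiniteDimensional k H] (φ : H →ₗ[k] k) (h : H) :
    contraction φ (Λ.elt ⊗ₜ h) = h * contraction φ (Λ.elt ⊗ₜ 1) := by
  rw [← contraction_comul_mul, Λ.comul_mul_elt_tmul, mul_one]

lemma contraction_elt_tmul_one (φ : H →ₗ[k] k) :
    contraction φ (Λ.elt ⊗ₜ 1) =
      TensorProduct.rid k H ((φ ∘ₗ antipode k).lTensor H (comul Λ.elt)) := by
  rw [contraction, LinearMap.comp_apply, LinearMap.comp_apply, galoisInv_tmul,
    ← Algebra.TensorProduct.one_def, mul_one, LinearMap.lTensor_comp_apply]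
  rfl

lemma exists_apply_elt_eq_one : ∃ φ : H →ₗ[k] k, φ Λ.elt = 1 :=
  Module.Projective.exists_dual_eq_one k Λ.ne_zero

/-- `Λ₁ ⊗ h Λ₂ = S(h) Λ₁ ⊗ Λ₂`. -/
lemma one_tmul_mul_comul_elt (h : H) :
    (1 ⊗ₜ[k] h) * comul Λ.elt = (antipode k h ⊗ₜ[k] 1) * comul Λ.elt := by
  -- For `w = h₁ ⊗ h₂`, both sides compute `S(h₁) h₂ Λ₁ ⊗ h₃ Λ₂`: the antipode axiom collapses the
  -- first two factors, while `h₂ Λ = ε(h₂) Λ` absorbs the last two.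
  have key₁ (w : H ⊗[k] H) :
      (LinearMap.mul' k H ∘ₗ (antipode k).rTensor H).rTensor H
        ((TensorProduct.assoc k H H H).symm (comul.lTensor H w)) * comul Λ.elt =
      (antipode k (TensorProduct.rid k H (counit.lTensor H w)) ⊗ₜ[k] 1) * comul Λ.elt := by
    induction w using TensorProduct.induction_on with
    | zero => simp
    | add x y hx hy => simp only [add_mul, map_add, add_tmul, hx, hy]
    | tmul x y =>
      have key₂ (z : H ⊗[k] H) : (LinearMap.mul' k H ∘ₗ (antipode k).rTensor H).rTensor H
          ((TensorProduct.assoc k H H H).symm (x ⊗ₜ z)) = (antipode k x ⊗ₜ 1) * z := by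
        induction z using TensorProduct.induction_on with
        | zero => simp
        | add x y hx hy => simp only [mul_add, map_add, tmul_add, hx, hy]
        | tmul x y => simp
      rw [LinearMap.lTensor_tmul, key₂, mul_assoc, ← Bialgebra.comul_mul, Λ.mul_elt]
      simp [← smul_tmul']
  have h₁ := key₁ (comul h)
  rw [lTensor_counit_comul, coassoc_symm_apply, ← LinearMap.rTensor_comp_apply,
    LinearMap.comp_assoc, mul_antipode_rTensor_comul, LinearMap.rTensor_comp_apply,
    rTensor_counit_comul] at h₁
  simpa using h₁

/-- The map `H* → H` given by `μ ↦ μ(Λ₁) Λ₂`. -/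
noncomputable def leftContraction : (H →ₗ[k] k) →ₗ[k] H where
  toFun μ := TensorProduct.lid k H (μ.rTensor H (comul Λ.elt))
  map_add' μ ν := by simp [LinearMap.rTensor_add]
  map_smul' c μ := by simp [LinearMap.rTensor_smul]

lemma mul_leftContraction (h : H) (μ : H →ₗ[k] k) :
    h * Λ.leftContraction μ =
      Λ.leftContraction (μ ∘ₗ LinearMap.mulLeft k (antipode k h)) := by
  have h₁ (w : H ⊗[k] H) : h * TensorProduct.lid k H (μ.rTensor H w) =
      TensorProduct.lid k H (μ.rTensor H ((1 ⊗ₜ h) * w)) := by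
    induction w using TensorProduct.induction_on with
    | zero => simp
    | add x y hx hy => simp only [mul_add, map_add, hx, hy]
    | tmul x y => simp
  have h₂ (g : H) (w : H ⊗[k] H) :
      TensorProduct.lid k H ((μ ∘ₗ LinearMap.mulLeft k g).rTensor H w) =
      TensorProduct.lid k H (μ.rTensor H ((g ⊗ₜ 1) * w)) := by
    induction w using TensorProduct.induction_on with
    | zero => simp
    | add x y hx hy => simp only [mul_add, map_add, hx, hy]
    | tmul x y => simp
  change h * TensorProduct.lid k H (μ.rTensor H (comul Λ.elt)) =
    TensorProduct.lid k H ((μ ∘ₗ LinearMap.mulLeft k (antipode k h)).rTensor H (comul Λ.elt))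
  rw [h₁, h₂, one_tmul_mul_comul_elt]

lemma mul_mem_range_leftContraction (h x : H) (hx : x ∈ LinearMap.range Λ.leftContraction) :
    h * x ∈ LinearMap.range Λ.leftContraction := by
  obtain ⟨μ, rfl⟩ := hx
  exact ⟨_, (Λ.mul_leftContraction h μ).symm⟩

/-- For an endomorphism `f` of `H`, the element `f(Λ₁) Λ₂` is of the form `μ(Λ₁) Λ₂`. -/
lemma mul'_rTensor_mem_range [FiniteDimensional k H] (f : H →ₗ[k] H) :
    LinearMap.mul' k H (f.rTensor H (comul Λ.elt)) ∈ LinearMap.range Λ.leftContraction := by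
  let b := Module.finBasis k H
  -- Expanding `f(Λ₁)` in a basis writes the element as a combination, with left coefficients in
  -- `H`, of members of the left ideal `range leftContraction`.
  have key (w : H ⊗[k] H) : LinearMap.mul' k H (f.rTensor H w) =
      ∑ i, b i * TensorProduct.lid k H ((b.coord i ∘ₗ f).rTensor H w) := by
    induction w using TensorProduct.induction_on with
    | zero => simp
    | add x y hx hy => simp only [mul_add, map_add, hx, hy, Finset.sum_add_distrib]
    | tmul x y =>
      simp only [LinearMap.rTensor_tmul, LinearMap.mul'_apply, LinearMap.comp_apply, lid_tmul,
        mul_smul_comm, ← smul_mul_assoc, ← Finset.sum_mul, Module.Basis.coord_apply, b.sum_repr]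
  rw [key]
  exact Submodule.sum_mem _ (fun i _ => Λ.mul_mem_range_leftContraction _ _ ⟨_, rfl⟩)

/-- Take `f(x) = μ(x₁) S(x₂)` with `μ(Λ) = 1`; then `f(Λ₁) Λ₂ = μ(Λ₁) S(Λ₂) Λ₃ = 1`. -/
lemma one_mem_range_leftContraction [FiniteDimensional k H] :
    (1 : H) ∈ LinearMap.range Λ.leftContraction := by
  obtain ⟨μ, hμ⟩ := Λ.exists_apply_elt_eq_one
  let f : H →ₗ[k] H :=
    (TensorProduct.lid k H).toLinearMap ∘ₗ TensorProduct.map μ (antipode k) ∘ₗ comul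
  have key (w : H ⊗[k] H) : LinearMap.mul' k H (f.rTensor H w) =
      TensorProduct.lid k H (TensorProduct.map μ (LinearMap.mul' k H ∘ₗ (antipode k).rTensor H)
        (TensorProduct.assoc k H H H (comul.rTensor H w))) := by
    induction w using TensorProduct.induction_on with
    | zero => simp
    | add x y hx hy => simp only [map_add, hx, hy]
    | tmul x y =>
      simp only [f, LinearMap.rTensor_tmul, LinearMap.comp_apply, LinearMap.mul'_apply,
        LinearEquiv.coe_coe]
      induction (comul x : H ⊗[k] H) using TensorProduct.induction_on with
      | zero => simp
      | add x y hx hy => simp only [add_mul, add_tmul, map_add, hx, hy]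
      | tmul x y => simp
  have h := Λ.mul'_rTensor_mem_range f
  rw [key, coassoc_apply, ← LinearMap.comp_apply, LinearMap.map_comp_lTensor,
    LinearMap.comp_assoc, mul_antipode_rTensor_comul, ← LinearMap.map_comp_lTensor,
    LinearMap.comp_apply, lTensor_counit_comul] at h
  simpa [hμ] using h

lemma leftContraction_surjective [FiniteDimensional k H] :
    Function.Surjective Λ.leftContraction := fun h => by
  simpa using Λ.mul_mem_range_leftContraction h 1 Λ.one_mem_range_leftContraction

lemma leftContraction_injective [FiniteDimensional k H] :
    Function.Injective Λ.leftContraction :=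
  (LinearMap.injective_iff_surjective_of_finrank_eq_finrank
    (Subspace.dual_finrank_eq (K := k) (V := H))).2 Λ.leftContraction_surjective

include Λ in
-- Write `1 = μ(Λ₁) Λ₂`. Then `h = μ(S(h) Λ₁) Λ₂`, which vanishes if `S(h) = 0`.
lemma antipode_bijective [FiniteDimensional k H] :
    Function.Bijective (antipode k : H →ₗ[k] H) := by
  have hinj : Function.Injective (antipode k : H →ₗ[k] H) := by
    rw [injective_iff_map_eq_zero]
    intro h hh
    obtain ⟨μ, hμ⟩ := Λ.one_mem_range_leftContraction
    have := Λ.mul_leftContraction h μ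
    rw [hμ, hh] at this
    simpa using this
  exact ⟨hinj, LinearMap.injective_iff_surjective.1 hinj⟩

/-- `μ ↦ Λ₁ μ(Λ₂)` is the transpose of `leftContraction`: a functional vanishing on its range is
killed by the injective `leftContraction`. -/
lemma exists_rid_lTensor_eq_one [FiniteDimensional k H] :
    ∃ μ : H →ₗ[k] k, TensorProduct.rid k H (μ.lTensor H (comul Λ.elt)) = 1 := by
  let R : (H →ₗ[k] k) →ₗ[k] H :=
    { toFun := fun μ => TensorProduct.rid k H (μ.lTensor H (comul Λ.elt))
      map_add' := fun μ ν => by simp [LinearMap.lTensor_add]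
      map_smul' := fun c μ => by simp [LinearMap.lTensor_smul] }
  suffices h : LinearMap.range R = ⊤ from LinearMap.range_eq_top.1 h 1
  by_contra h
  obtain ⟨f, hf, hfR⟩ := Submodule.exists_le_ker_of_lt_top _ (lt_top_iff_ne_top.2 h)
  apply hf
  apply Λ.leftContraction_injective
  rw [map_zero]
  refine (Module.forall_dual_apply_eq_zero_iff k _).1 (fun μ => ?_)
  have key (w : H ⊗[k] H) : μ (TensorProduct.lid k H (f.rTensor H w)) =
      f (TensorProduct.rid k H (μ.lTensor H w)) := by
    induction w using TensorProduct.induction_on with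
    | zero => simp
    | add x y hx hy => simp only [map_add, hx, hy]
    | tmul x y => simp [mul_comm]
  exact (key _).trans (hfR ⟨μ, rfl⟩)

lemma exists_contraction_eq [FiniteDimensional k H] :
    ∃ φ : H →ₗ[k] k, ∀ h : H, contraction φ (Λ.elt ⊗ₜ h) = h := by
  obtain ⟨μ, hμ⟩ := Λ.exists_rid_lTensor_eq_one
  let S := LinearEquiv.ofBijective (antipode k : H →ₗ[k] H) Λ.antipode_bijective
  -- Composing with `S⁻¹` cancels the antipode in `Λ₁ φ(S(Λ₂))`.
  refine ⟨μ ∘ₗ S.symm.toLinearMap, fun h => ?_⟩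
  have hS : (μ ∘ₗ S.symm.toLinearMap) ∘ₗ antipode k = μ := by
    ext x
    exact congrArg μ (S.symm_apply_apply x)
  rw [contraction_elt_tmul, contraction_elt_tmul_one, hS, hμ, mul_one]

end LeftIntegral

end Hopfological

/-! ### Tensor modules over the comodule algebra and their splittings -/

noncomputable section

namespace Hopfological

open CategoryTheory CategoryTheory.Limits TensorProduct Coalgebra
open scoped ModuleCat

universe u v u'

variable {k : Type u} {H : Type v} {A : Type u'} [Field k] [Ring H] [HopfAlgebra k H]
  [Ring A] [Algebra k A] (δ : LeftComoduleAlgebra k H A)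

/-- The action of `B ⊗ A` on `V ⊗ M`, for `V` a module over `B` and `M` a module over `A`. -/
def pairAction (B : Type*) [Ring B] [Algebra k B] (V : Type*) [AddCommGroup V] [Module k V]
    [Module B V] [IsScalarTower k B V] (M : Type*) [AddCommGroup M] [Module k M] [Module A M]
    [IsScalarTower k A M] : B ⊗[k] A →ₐ[k] Module.End k (V ⊗[k] M) :=
  (Module.endTensorEndAlgHom (R := k) (S := k) (A := k) (M := V) (N := M)).comp
    (Algebra.TensorProduct.map (Algebra.lsmul k k V) (Algebra.lsmul k k M))

@[simp]
lemma pairAction_tmul {B : Type*} [Ring B] [Algebra k B] {V : Type*} [AddCommGroup V]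
    [Module k V] [Module B V] [IsScalarTower k B V] {M : Type*} [AddCommGroup M] [Module k M]
    [Module A M] [IsScalarTower k A M] (b : B) (a : A) (v : V) (m : M) :
    pairAction B V M (b ⊗ₜ[k] a) (v ⊗ₜ[k] m) = (b • v) ⊗ₜ[k] (a • m) := by
  simp [pairAction, Module.endTensorEndAlgHom_apply]

variable (V : Type v) [AddCommGroup V] [Module k V] [Module H V] [IsScalarTower k H V]
  (M : ModuleCat.{v} A)

/-- The `k`-module underlying the `A`-module `V ⊗ M` is the tensor product over `k`. -/
def tensorEquiv : (tensorFunctor δ V).obj M ≃ₗ[k] V ⊗[k] M where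
  toFun x := x
  invFun x := x
  left_inv _ := rfl
  right_inv _ := rfl
  map_add' _ _ := rfl
  map_smul' c x := by
    change tensorAction δ V M (algebraMap k A c) x = c • (show V ⊗[k] M from x)
    rw [AlgHom.commutes]
    rfl

variable {V M}

lemma tensorEquiv_smul (a : A) (x : (tensorFunctor δ V).obj M) :
    tensorEquiv δ V M (a • x) = pairAction H V M (δ.coact a) (tensorEquiv δ V M x) := rfl

lemma tensorEquiv_map {N : ModuleCat.{v} A} (f : M ⟶ N) (x : (tensorFunctor δ V).obj M) :
    tensorEquiv δ V N ((tensorFunctor δ V).map f x) =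
      (f.hom.restrictScalars k).lTensor V (tensorEquiv δ V M x) := rfl

variable (M)

/-- The identification of the `A`-module `H ⊗ (H ⊗ M)` with the `k`-module `(H ⊗ H) ⊗ M`. -/
def doubleEquiv : (tensorFunctor δ H).obj ((tensorFunctor δ H).obj M) ≃ₗ[k] (H ⊗[k] H) ⊗[k] M :=
  tensorEquiv δ H _ ≪≫ₗ (tensorEquiv δ H M).lTensor H ≪≫ₗ (TensorProduct.assoc k H H M).symm

variable {M}

lemma doubleEquiv_symm_tmul (g g' : H) (m : M) :
    (doubleEquiv δ M).symm ((g ⊗ₜ g') ⊗ₜ m) =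
      (tensorEquiv δ H _).symm (g ⊗ₜ (tensorEquiv δ H M).symm (g' ⊗ₜ m)) := by
  rw [LinearEquiv.symm_apply_eq]
  simp [doubleEquiv]

lemma doubleEquiv_tensorEquiv_symm (g : H) (z : H ⊗[k] M) :
    doubleEquiv δ M ((tensorEquiv δ H _).symm (g ⊗ₜ (tensorEquiv δ H M).symm z)) =
      (TensorProduct.assoc k H H M).symm (g ⊗ₜ z) := by
  simp [doubleEquiv]

/-- Coassociativity of the coaction: acting twice through `A` is the diagonal action of `H` on `H ⊗
H`, so `H`-linear maps between `H` and `H ⊗ H` induce `A`-linear maps. -/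
lemma doubleEquiv_smul (a : A) (x : (tensorFunctor δ H).obj ((tensorFunctor δ H).obj M)) :
    doubleEquiv δ M (a • x) =
      pairAction (H ⊗[k] H) (H ⊗[k] H) M (comul.rTensor A (δ.coact a)) (doubleEquiv δ M x) := by
  obtain ⟨x, rfl⟩ := (doubleEquiv δ M).symm.surjective x
  have h : comul.rTensor A (δ.coact a) = (TensorProduct.assoc k H H A).symm
      (δ.coact.toLinearMap.lTensor H (δ.coact a)) := by
    rw [← δ.coassoc, LinearEquiv.symm_apply_apply]
  rw [h, LinearEquiv.apply_symm_apply, ← (tensorEquiv δ H _).symm_apply_apply (a • _),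
    tensorEquiv_smul]
  induction δ.coact a using TensorProduct.induction_on with
  | zero => simp
  | add y z hy hz => simp only [map_add, LinearMap.add_apply, hy, hz]
  | tmul h b =>
    induction x using TensorProduct.induction_on with
    | zero => simp
    | add y z hy hz => simp only [map_add, hy, hz]
    | tmul w m =>
      induction w using TensorProduct.induction_on with
      | zero => simp
      | add y z hy hz => simp only [add_tmul, map_add, hy, hz]
      | tmul g g' =>
        rw [doubleEquiv_symm_tmul, LinearEquiv.apply_symm_apply, pairAction_tmul,
          ← (tensorEquiv δ H M).symm_apply_apply (b • _), tensorEquiv_smul,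
          LinearEquiv.apply_symm_apply, doubleEquiv_tensorEquiv_symm, LinearMap.lTensor_tmul,
          AlgHom.toLinearMap_apply]
        induction δ.coact b using TensorProduct.induction_on with
        | zero => simp
        | add y z hy hz => simp only [map_add, LinearMap.add_apply, tmul_add, hy, hz]
        | tmul h' b' => simp

/-- A morphism of modules from a linear map between the underlying types. -/
def moduleHomMk {X Y : ModuleCat.{v} A} (f : X →+ Y) (hf : ∀ (a : A) x, f (a • x) = a • f x) :
    X ⟶ Y :=
  ModuleCat.ofHom { toFun := f, map_add' := f.map_add, map_smul' := hf }

variable (M)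

/-- The `A`-linear map `H ⊗ (H ⊗ M) → H ⊗ M` induced by an `H`-linear map `H ⊗ H → H`. -/
def foldMap (φ : H ⊗[k] H →ₗ[k] H) (hφ : ∀ h z, φ (comul h * z) = h * φ z) :
    (tensorFunctor δ H).obj ((tensorFunctor δ H).obj M) ⟶ (tensorFunctor δ H).obj M :=
  moduleHomMk
    ((tensorEquiv δ H M).symm.toLinearMap ∘ₗ φ.rTensor M ∘ₗ
      (doubleEquiv δ M).toLinearMap).toAddMonoidHom
    (fun a x => by
      change (tensorEquiv δ H M).symm (φ.rTensor M (doubleEquiv δ M (a • x))) =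
        a • (tensorEquiv δ H M).symm (φ.rTensor M (doubleEquiv δ M x))
      rw [doubleEquiv_smul, LinearEquiv.symm_apply_eq, tensorEquiv_smul,
        LinearEquiv.apply_symm_apply]
      induction δ.coact a using TensorProduct.induction_on with
      | zero => simp
      | add y z hy hz => simp only [map_add, LinearMap.add_apply, hy, hz]
      | tmul h b =>
        induction doubleEquiv δ M x using TensorProduct.induction_on with
        | zero => simp
        | add y z hy hz => simp only [map_add, hy, hz]
        | tmul w m => simp [hφ])

/-- The `A`-linear map `H ⊗ M → H ⊗ (H ⊗ M)` induced by the comultiplication of `H`. -/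
def comulMap : (tensorFunctor δ H).obj M ⟶
    (tensorFunctor δ H).obj ((tensorFunctor δ H).obj M) :=
  moduleHomMk
    ((doubleEquiv δ M).symm.toLinearMap ∘ₗ comul.rTensor M ∘ₗ
      (tensorEquiv δ H M).toLinearMap).toAddMonoidHom
    (fun a x => by
      change (doubleEquiv δ M).symm (comul.rTensor M (tensorEquiv δ H M (a • x))) =
        a • (doubleEquiv δ M).symm (comul.rTensor M (tensorEquiv δ H M x))
      rw [LinearEquiv.symm_apply_eq, doubleEquiv_smul, tensorEquiv_smul,
        LinearEquiv.apply_symm_apply]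
      induction δ.coact a using TensorProduct.induction_on with
      | zero => simp
      | add y z hy hz => simp only [map_add, LinearMap.add_apply, hy, hz]
      | tmul h b =>
        induction tensorEquiv δ H M x using TensorProduct.induction_on with
        | zero => simp
        | add y z hy hz => simp only [map_add, hy, hz]
        | tmul g m => simp [Bialgebra.comul_mul])

/-- The `A`-linear map `H ⊗ M → M` induced by the counit of `H`. -/
def counitMap : (tensorFunctor δ H).obj M ⟶ M :=
  moduleHomMk
    ((TensorProduct.lid k M).toLinearMap ∘ₗ counit.rTensor M ∘ₗ
      (tensorEquiv δ H M).toLinearMap).toAddMonoidHom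
    (fun a x => by
      change TensorProduct.lid k M (counit.rTensor M (tensorEquiv δ H M (a • x))) =
        a • TensorProduct.lid k M (counit.rTensor M (tensorEquiv δ H M x))
      rw [tensorEquiv_smul]
      conv_rhs => rw [← δ.counit_coact a]
      induction δ.coact a using TensorProduct.induction_on with
      | zero => simp
      | add y z hy hz => simp only [map_add, LinearMap.add_apply, add_smul, hy, hz]
      | tmul h b =>
        induction tensorEquiv δ H M x using TensorProduct.induction_on with
        | zero => simp
        | add y z hy hz => simp only [map_add, smul_add, hy, hz]
        | tmul g m => simp [mul_smul, smul_comm _ b])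

variable {M}

lemma foldMap_apply (φ : H ⊗[k] H →ₗ[k] H) (hφ : ∀ h z, φ (comul h * z) = h * φ z) (x) :
    foldMap δ M φ hφ x = (tensorEquiv δ H M).symm (φ.rTensor M (doubleEquiv δ M x)) := rfl

lemma comulMap_apply (x) :
    comulMap δ M x = (doubleEquiv δ M).symm (comul.rTensor M (tensorEquiv δ H M x)) := rfl

lemma counitMap_apply (x) :
    counitMap δ M x = TensorProduct.lid k M (counit.rTensor M (tensorEquiv δ H M x)) := rfl

instance (M : ModuleCat.{v} A) : Epi (counitMap δ M) := by
  rw [ModuleCat.epi_iff_surjective]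
  intro m
  exact ⟨(tensorEquiv δ H M).symm (1 ⊗ₜ m), by simp [counitMap_apply]⟩

lemma unitMap_apply (Λ : LeftIntegral k H) (m : M) :
    unitMap (δ := δ) Λ M m = (tensorEquiv δ H M).symm (Λ.elt ⊗ₜ m) := rfl

lemma tensor_hom_ext {N : ModuleCat.{v} A} {f g : (tensorFunctor δ V).obj M ⟶ N}
    (h : ∀ v m, f ((tensorEquiv δ V M).symm (v ⊗ₜ m)) = g ((tensorEquiv δ V M).symm (v ⊗ₜ m))) :
    f = g := by
  ext x
  obtain ⟨x, rfl⟩ := (tensorEquiv δ V M).symm.surjective x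
  induction x using TensorProduct.induction_on with
  | zero => simp
  | add y z hy hz => simp only [map_add, hy, hz]
  | tmul v m => exact h v m

lemma unitMap_naturality (Λ : LeftIntegral k H) {N : ModuleCat.{v} A} (f : M ⟶ N) :
    f ≫ unitMap (δ := δ) Λ N = unitMap (δ := δ) Λ M ≫ (tensorFunctor δ H).map f := rfl

lemma quotMap_naturality (Λ : LeftIntegral k H) {N : ModuleCat.{v} A} (f : M ⟶ N) :
    (tensorFunctor δ H).map f ≫ quotMap Λ N = quotMap (δ := δ) Λ M ≫ (shiftT δ Λ).map f :=
  tensor_hom_ext δ (fun _ _ => rfl)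

lemma counitMap_naturality {N : ModuleCat.{v} A} (f : M ⟶ N) :
    (tensorFunctor δ H).map f ≫ counitMap δ N = counitMap δ M ≫ f :=
  tensor_hom_ext δ (fun h m => by
    simp [counitMap_apply, tensorEquiv_map])

lemma unitMap_foldMap (Λ : LeftIntegral k H) (φ : H ⊗[k] H →ₗ[k] H)
    (hφ : ∀ h z, φ (comul h * z) = h * φ z) (h : ∀ h, φ (Λ.elt ⊗ₜ h) = h) :
    unitMap (δ := δ) Λ _ ≫ foldMap δ M φ hφ = 𝟙 _ :=
  tensor_hom_ext δ (fun g m => by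
    simp [unitMap_apply, foldMap_apply, doubleEquiv_tensorEquiv_symm, h])

lemma map_unitMap_foldMap (Λ : LeftIntegral k H) (φ : H ⊗[k] H →ₗ[k] H)
    (hφ : ∀ h z, φ (comul h * z) = h * φ z) (h : ∀ h, φ (h ⊗ₜ Λ.elt) = h) :
    (tensorFunctor δ H).map (unitMap Λ M) ≫ foldMap δ M φ hφ = 𝟙 _ :=
  tensor_hom_ext δ (fun g m => by
    have : (tensorFunctor δ H).map (unitMap Λ M) ((tensorEquiv δ H M).symm (g ⊗ₜ m)) =
        (doubleEquiv δ M).symm ((g ⊗ₜ Λ.elt) ⊗ₜ m) := by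
      rw [doubleEquiv_symm_tmul]
      rfl
    simp [this, foldMap_apply, h])

lemma comulMap_counitMap : comulMap δ M ≫ counitMap δ _ = 𝟙 _ :=
  tensor_hom_ext δ (fun g m => by
    have key (w : H ⊗[k] H) : counitMap δ _ ((doubleEquiv δ M).symm (w ⊗ₜ m)) =
        (tensorEquiv δ H M).symm (TensorProduct.lid k H (counit.rTensor H w) ⊗ₜ m) := by
      induction w using TensorProduct.induction_on with
      | zero => simp
      | add y z hy hz => simp only [map_add, add_tmul, hy, hz]
      | tmul h h' =>
        rw [doubleEquiv_symm_tmul, counitMap_apply]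
        simp [← smul_tmul']
    simp [comulMap_apply, key])

lemma comulMap_map_counitMap : comulMap δ M ≫ (tensorFunctor δ H).map (counitMap δ M) = 𝟙 _ :=
  tensor_hom_ext δ (fun g m => by
    have key (w : H ⊗[k] H) :
        (tensorFunctor δ H).map (counitMap δ M) ((doubleEquiv δ M).symm (w ⊗ₜ m)) =
        (tensorEquiv δ H M).symm (TensorProduct.rid k H (counit.lTensor H w) ⊗ₜ m) := by
      induction w using TensorProduct.induction_on with
      | zero => simp
      | add y z hy hz => simp only [map_add, add_tmul, hy, hz]
      | tmul h h' =>
        rw [doubleEquiv_symm_tmul, LinearEquiv.eq_symm_apply, tensorEquiv_map]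
        simp [counitMap_apply, smul_tmul]
    simp [comulMap_apply, key])

lemma shortExact_map_tensorFunctor (S : ShortComplex (ModuleCat.{v} A)) (hS : S.ShortExact) :
    (S.map (tensorFunctor δ V)).ShortExact := by
  have hf := (ModuleCat.mono_iff_injective _).1 hS.mono_f
  have hg := (ModuleCat.epi_iff_surjective _).1 hS.epi_g
  have hfg := (ShortComplex.ShortExact.moduleCat_exact_iff_function_exact S).1 hS.exact
  exact
    { exact := (ShortComplex.ShortExact.moduleCat_exact_iff_function_exact _).2
        (lTensor_exact V (f := S.f.hom.restrictScalars k) (g := S.g.hom.restrictScalars k) hfg hg)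
      mono_f := (ModuleCat.mono_iff_injective _).2
        (Module.Flat.lTensor_preserves_injective_linearMap (M := V)
          (S.f.hom.restrictScalars k) hf)
      epi_g := (ModuleCat.epi_iff_surjective _).2
        (LinearMap.lTensor_surjective V (g := S.g.hom.restrictScalars k) hg) }

/-- Over the field `k`, this is the sequence `k ⟶ H ⟶ H / kΛ` tensored with `M`. -/
lemma shortExact_unitMap_quotMap (Λ : LeftIntegral k H) (M : ModuleCat.{v} A) :
    (ShortComplex.mk _ _ (unitMap_quotMap δ Λ M)).ShortExact := by
  let f : k →ₗ[k] H := LinearMap.toSpanSingleton k H Λ.elt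
  let g : H →ₗ[k] H ⧸ Λ.line := Λ.line.mkQ.restrictScalars k
  have hf : Function.Injective f := by
    simpa [f] using LinearMap.ker_eq_bot.1 (LinearMap.ker_toSpanSingleton k Λ.ne_zero)
  have hg : Function.Surjective g := Λ.line.mkQ_surjective
  have hfg : Function.Exact f g := fun x => by
    change Λ.line.mkQ x = 0 ↔ _
    rw [Submodule.mkQ_apply, Submodule.Quotient.mk_eq_zero]
    exact ⟨fun ⟨c, hc⟩ => ⟨c, hc.symm⟩, fun ⟨c, hc⟩ => ⟨c, hc.symm⟩⟩
  have hu : ∀ m, unitMap (δ := δ) Λ M m =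
      (tensorEquiv δ H M).symm (f.rTensor M ((TensorProduct.lid k M).symm m)) := fun m => by
    simp [unitMap_apply, f]
  refine
    { exact := (ShortComplex.ShortExact.moduleCat_exact_iff_function_exact _).2 ?_
      mono_f := (ModuleCat.mono_iff_injective _).2 ?_
      epi_g := (ModuleCat.epi_iff_surjective _).2 (LinearMap.rTensor_surjective M hg) }
  · intro x
    refine (rTensor_exact M hfg hg x).trans ⟨?_, ?_⟩
    · rintro ⟨y, hy⟩
      exact ⟨TensorProduct.lid k M y, by
        change unitMap Λ M _ = _
        rw [hu, LinearEquiv.symm_apply_apply, hy]; rfl⟩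
    · rintro ⟨m, hm⟩
      exact ⟨(TensorProduct.lid k M).symm m, (hu m).symm.trans hm⟩
  · intro m m' h
    have h' : unitMap (δ := δ) Λ M m = unitMap Λ M m' := h
    rw [hu, hu] at h'
    exact (TensorProduct.lid k M).symm.injective
      (Module.Flat.rTensor_preserves_injective_linearMap (M := M) f hf
        ((tensorEquiv δ H M).symm.injective h'))

end Hopfological

end

/-! ### The stable category of a comodule algebra -/

noncomputable section

namespace Hopfological

open CategoryTheory CategoryTheory.Limits CategoryTheory.Pretriangulated

universe u v u'

variable {k : Type u} {H : Type v} {A : Type u'} [Field k] [Ring H] [HopfAlgebra k H]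
  [Ring A] [Algebra k A] (δ : LeftComoduleAlgebra k H A)

variable [FiniteDimensional k H] (Λ : LeftIntegral k H)

/-- The functor `H ⊗ -` on modules over a left `H`-comodule algebra defines a relative Frobenius
structure. -/
def relativeFrobenius : RelativeFrobenius (ModuleCat.{v} A) where
  I := tensorFunctor δ H
  T := shiftT δ Λ
  additive := inferInstance
  shortExact_map := shortExact_map_tensorFunctor δ
  ι := unitMap Λ
  q := quotMap Λ
  ε := counitMap δ
  ι_naturality := unitMap_naturality δ Λ
  q_naturality := quotMap_naturality δ Λ
  ε_naturality := counitMap_naturality δ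
  ι_q := unitMap_quotMap δ Λ
  shortExact := shortExact_unitMap_quotMap δ Λ
  epi_ε := inferInstance
  ι_retraction M := by
    obtain ⟨φ, hφ⟩ := Λ.exists_contraction_eq
    exact ⟨_, unitMap_foldMap δ Λ _ (contraction_comul_mul φ) hφ⟩
  map_ι_retraction M := by
    obtain ⟨φ, hφ⟩ := Λ.exists_apply_elt_eq_one
    exact ⟨_, map_unitMap_foldMap δ Λ _ (contraction_comul_mul φ)
      (fun h => by rw [Λ.contraction_tmul_elt, hφ, one_smul])⟩
  ε_section M := ⟨_, comulMap_counitMap δ⟩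
  map_ε_section M := ⟨_, comulMap_map_counitMap δ⟩

lemma isStableQuotient : (relativeFrobenius δ Λ).IsStableQuotient (toStable δ) where
  additive := inferInstance
  full := inferInstanceAs (CategoryTheory.Quotient.functor (homotopyRel δ)).Full
  essSurj := inferInstanceAs (CategoryTheory.Quotient.functor (homotopyRel δ)).EssSurj
  map_eq_zero_iff f := by
    rw [← (toStable δ).map_zero]
    refine (CategoryTheory.Quotient.functor_map_eq_iff (homotopyRel δ) f 0).trans ?_
    change NullHomotopic δ (f - 0) ↔ NullHomotopic δ f
    rw [sub_zero]

/-- The functor induced by `T` on the stable category. -/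
def stableShift : StableCat δ ⥤ StableCat δ :=
  CategoryTheory.Quotient.lift (homotopyRel δ) (shiftT δ Λ ⋙ toStable δ) (fun X Y f g h => by
    have h₀ : (toStable δ).map ((shiftT δ Λ).map (f - g)) = 0 :=
      (isStableQuotient δ Λ).map_T_eq_zero h
    have : (shiftT δ Λ).Additive :=
      inferInstanceAs (relativeFrobenius δ Λ).T.Additive
    rwa [Functor.map_sub, Functor.map_sub, sub_eq_zero] at h₀)

/-- The functor induced by `T` on the stable category is compatible with `T`. -/
def toStableCompStableShift : toStable δ ⋙ stableShift δ Λ ≅ shiftT δ Λ ⋙ toStable δ :=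
  CategoryTheory.Quotient.lift.isLift _ _ _

instance : (stableShift δ Λ).IsEquivalence :=
  (isStableQuotient δ Λ).isEquivalence (toStableCompStableShift δ Λ)

instance : (stableShift δ Λ).Additive := by
  have := (isStableQuotient δ Λ).full
  have := (isStableQuotient δ Λ).essSurj
  have : (shiftT δ Λ).Additive := inferInstanceAs (relativeFrobenius δ Λ).T.Additive
  have : (toStable δ ⋙ stableShift δ Λ).Additive :=
    Functor.additive_of_iso (toStableCompStableShift δ Λ).symm
  exact Functor.additive_of_full_essSurj_comp (toStable δ) _

end Hopfological

end

open CategoryTheory CategoryTheory.Pretriangulated Hopfological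

universe u v u'

theorem mainTheorem1 {k : Type u} {H : Type v} {A : Type u'} [Field k] [Ring H] [HopfAlgebra k H]
    [FiniteDimensional k H] [Ring A] [Algebra k A]
    (δ : LeftComoduleAlgebra k H A) (Λ : LeftIntegral k H) :
    ∃ (_ : HasShift (StableCat δ) ℤ)
      (_ : ∀ n : ℤ, (shiftFunctor (StableCat δ) n).Additive)
      (e : toStable δ ⋙ shiftFunctor (StableCat δ) (1 : ℤ) ≅ shiftT δ Λ ⋙ toStable δ)
      (P : Pretriangulated (StableCat δ)),
      (∀ t : Triangle (StableCat δ), t ∈ P.distinguishedTriangles ↔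
        ∃ (X Y : ModuleCat.{v} A) (u : X ⟶ Y), Nonempty (t ≅ standardTriangle δ Λ u e)) ∧
      IsTriangulated (StableCat δ) := by
  let hs : HasShift (StableCat δ) ℤ := (stableShift δ Λ).hasShiftOfIsEquivalence
  let i : shiftFunctor (StableCat δ) (1 : ℤ) ≅ stableShift δ Λ := (stableShift δ Λ).shiftPowOneIso
  have hadd : ∀ n : ℤ, (shiftFunctor (StableCat δ) n).Additive :=
    shiftFunctor_additive_of_one (Functor.additive_of_iso i.symm)
  let e : toStable δ ⋙ shiftFunctor (StableCat δ) (1 : ℤ) ≅ shiftT δ Λ ⋙ toStable δ :=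
    Functor.isoWhiskerLeft (toStable δ) i ≪≫ toStableCompStableShift δ Λ
  -- `standardTriangle` agrees definitionally with the abstract `stdTriangle`, so the description of
  -- distinguished triangles is `Iff.rfl`.
  exact ⟨hs, hadd, e, (isStableQuotient δ Λ).pretriangulated e, fun t => Iff.rfl,
    (isStableQuotient δ Λ).isTriangulated⟩
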